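/- Let $N\ge 2$, let $\Omega\subset\mathbb R^N$ be a bounded smooth domain (it is enough that $\partial\Omega$ is of class $C^2$), let $\delta(x)=\operatorname{dist}(x,\partial\Omega)$, let $\Omega_\rho=\{x\in\Omega:\delta(x)<\rho\}$ for $\rho>0$, and let $\mu\in\mathbb R$. For an open set $G\subset\Omega$, a super-harmonic in $G$ is a function $h\in H^1_{loc}(G)\cap C(G)$ such that $$\int_G\nabla h\cdot\nabla\varphi\,dx-\int_G\frac{\mu}{\delta^2}\,h\,\varphi\,dx\ \ge\ 0\qquad\text{for all }0\le\varphi\in H^1_c(G),$$ where $H^1_c(G)$ is the space of functions in $H^1(G)$ with compact support in $G$; $h$ is a solution of $-\Delta h-\frac{\mu}{\delta^2}h=0$ in $G$ if $h\in H^1_{loc}(G)\cap C(G)$ and equality holds for all $\varphi\in H^1_c(G)$. Theorem 2.1. There exist $\rho>0$ and a super-harmonic $h$ in $\Omega_\rho$ with $h>0$ in $\Omega_\rho$ if and only if $\mu\le\frac14$. In particular, if $\mu>\frac14$, then the equation $-\Delta h-\frac{\mu}{\delta^2}h=0$ in $\Omega$ has no solution $h\ge 0$ in $\Omega$ other than $h\equiv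 0$. -/

import Mathlib

open MeasureTheory
open scoped ContDiff

noncomputable section

namespace HardyPotential

/-- The distance `δ(x) = dist(x, ∂Ω)` to the boundary of `Ω`. -/
def bdist {N : ℕ} (Ω : Set (EuclideanSpace ℝ (Fin N))) (x : EuclideanSpace ℝ (Fin N)) : ℝ :=
  Metric.infDist x (frontier Ω)

/-- The boundary strip `Ω_ρ = {x ∈ Ω : δ(x) < ρ}`. -/
def strip {N : ℕ} (Ω : Set (EuclideanSpace ℝ (Fin N))) (ρ : ℝ) :
    Set (EuclideanSpace ℝ (Fin N)) :=
  {x | x ∈ Ω ∧ bdist Ω x < ρ}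

/-- The boundary of `Ω` is of class `C²`: near each of its points, `Ω` is the sublevel set
`{f < 0}` of a `C²` function `f` with non-vanishing derivative. -/
def HasC2Boundary {N : ℕ} (Ω : Set (EuclideanSpace ℝ (Fin N))) : Prop :=
  ∀ p ∈ frontier Ω, ∃ U : Set (EuclideanSpace ℝ (Fin N)), IsOpen U ∧ p ∈ U ∧
    ∃ f : EuclideanSpace ℝ (Fin N) → ℝ, ContDiffOn ℝ 2 f U ∧
      (∀ x ∈ U, fderiv ℝ f x ≠ 0) ∧ Ω ∩ U = {x | x ∈ U ∧ f x < 0}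

/-- A bounded domain (nonempty connected open set) with `C²` boundary. -/
structure IsBoundedC2Domain {N : ℕ} (Ω : Set (EuclideanSpace ℝ (Fin N))) : Prop where
  isOpen : IsOpen Ω
  isConnected : IsConnected Ω
  isBounded : Bornology.IsBounded Ω
  boundary : HasC2Boundary Ω

/-- `g` is the weak (distributional) gradient of `u` in the open set `G`. -/
structure HasWeakGradient {N : ℕ} (G : Set (EuclideanSpace ℝ (Fin N)))
    (u : EuclideanSpace ℝ (Fin N) → ℝ)
    (g : EuclideanSpace ℝ (Fin N) → EuclideanSpace ℝ (Fin N)) : Prop where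
  locInt : LocallyIntegrableOn u G volume
  locInt_grad : LocallyIntegrableOn g G volume
  integral_eq : ∀ ψ : EuclideanSpace ℝ (Fin N) → ℝ, ContDiff ℝ ∞ ψ → HasCompactSupport ψ →
    tsupport ψ ⊆ G → ∀ v : EuclideanSpace ℝ (Fin N),
      ∫ x in G, u x * fderiv ℝ ψ x v = - ∫ x in G, inner ℝ (g x) v * ψ x

/-- `u ∈ H¹_loc(G)`, with weak gradient `g`. -/
structure IsH1Loc {N : ℕ} (G : Set (EuclideanSpace ℝ (Fin N)))
    (u : EuclideanSpace ℝ (Fin N) → ℝ)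
    (g : EuclideanSpace ℝ (Fin N) → EuclideanSpace ℝ (Fin N)) : Prop where
  weakGrad : HasWeakGradient G u g
  memLp : ∀ K ⊆ G, IsCompact K → MemLp u 2 (volume.restrict K)
  memLp_grad : ∀ K ⊆ G, IsCompact K → MemLp g 2 (volume.restrict K)

/-- `φ ∈ H¹_c(G)`, with weak gradient `g`: an element of `H¹(G)` that vanishes almost everywhere
outside a compact subset of `G`. -/
structure IsH1Compact {N : ℕ} (G : Set (EuclideanSpace ℝ (Fin N)))
    (φ : EuclideanSpace ℝ (Fin N) → ℝ)
    (g : EuclideanSpace ℝ (Fin N) → EuclideanSpace ℝ (Fin N)) : Prop where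
  weakGrad : HasWeakGradient G φ g
  memLp : MemLp φ 2 (volume.restrict G)
  memLp_grad : MemLp g 2 (volume.restrict G)
  compactSupport : ∃ K ⊆ G, IsCompact K ∧ ∀ᵐ x ∂(volume.restrict G), x ∉ K → φ x = 0

/-- The weak form `∫_G ∇h·∇φ dx - ∫_G (μ/δ²) h φ dx` of `-Δ - μ/δ²`, where `Dh`, `Dφ` are the
weak gradients of `h`, `φ`. -/
def weakForm {N : ℕ} (Ω : Set (EuclideanSpace ℝ (Fin N))) (μ : ℝ)
    (G : Set (EuclideanSpace ℝ (Fin N)))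
    (h : EuclideanSpace ℝ (Fin N) → ℝ)
    (Dh : EuclideanSpace ℝ (Fin N) → EuclideanSpace ℝ (Fin N))
    (φ : EuclideanSpace ℝ (Fin N) → ℝ)
    (Dφ : EuclideanSpace ℝ (Fin N) → EuclideanSpace ℝ (Fin N)) : ℝ :=
  (∫ x in G, inner ℝ (Dh x) (Dφ x)) - ∫ x in G, μ / bdist Ω x ^ 2 * h x * φ x

/-- `h` is a super-harmonic of `-Δ - μ/δ²` in the open set `G ⊆ Ω`. -/
def IsSuperharmonic {N : ℕ} (Ω : Set (EuclideanSpace ℝ (Fin N))) (μ : ℝ)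
    (G : Set (EuclideanSpace ℝ (Fin N))) (h : EuclideanSpace ℝ (Fin N) → ℝ) : Prop :=
  ContinuousOn h G ∧
    ∃ Dh : EuclideanSpace ℝ (Fin N) → EuclideanSpace ℝ (Fin N), IsH1Loc G h Dh ∧
      ∀ (φ : EuclideanSpace ℝ (Fin N) → ℝ)
        (Dφ : EuclideanSpace ℝ (Fin N) → EuclideanSpace ℝ (Fin N)),
        IsH1Compact G φ Dφ → (∀ᵐ x ∂(volume.restrict G), 0 ≤ φ x) →
          0 ≤ weakForm Ω μ G h Dh φ Dφ

/-- `h` is a (weak, continuous) solution of `-Δh - μh/δ² = 0` in the open set `G ⊆ Ω`. -/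
def IsSolution {N : ℕ} (Ω : Set (EuclideanSpace ℝ (Fin N))) (μ : ℝ)
    (G : Set (EuclideanSpace ℝ (Fin N))) (h : EuclideanSpace ℝ (Fin N) → ℝ) : Prop :=
  ContinuousOn h G ∧
    ∃ Dh : EuclideanSpace ℝ (Fin N) → EuclideanSpace ℝ (Fin N), IsH1Loc G h Dh ∧
      ∀ (φ : EuclideanSpace ℝ (Fin N) → ℝ)
        (Dφ : EuclideanSpace ℝ (Fin N) → EuclideanSpace ℝ (Fin N)),
        IsH1Compact G φ Dφ → weakForm Ω μ G h Dh φ Dφ = 0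

/-- `h` is a positive local super-harmonic: for some `ρ > 0` it is a super-harmonic in the strip
`Ω_ρ` and strictly positive there. -/
def IsPositiveLocalSuperharmonic {N : ℕ} (Ω : Set (EuclideanSpace ℝ (Fin N))) (μ : ℝ)
    (h : EuclideanSpace ℝ (Fin N) → ℝ) : Prop :=
  ∃ ρ : ℝ, 0 < ρ ∧ IsSuperharmonic Ω μ (strip Ω ρ) h ∧ ∀ x ∈ strip Ω ρ, 0 < h x

end HardyPotential

end

/-!
Both directions rest on comparison with one-dimensional functions of the distance `δ`; `√t` is the
critical solution of `-u'' = u / (4 t²)`.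

*Nonexistence for `μ > 1/4`.* The equation `-u'' = (1/4 + κ²) u / t²` oscillates: it is solved by
`√t cos(κ log t)`. A smooth compactly supported profile `√t z(log t / A)`, with `z` a bump for
which `z'' / z` is bounded below, is therefore a subsolution of the equation with `1/4 + 16/A²`
(`hardyProfile_deriv_deriv_ge`). Multiplied by wide bumps in the tangential directions and placed
at a small scale at a boundary point, where `Ω` looks like a half-space (`exists_inner_normal`),
it gives a smooth `φ ≥ 0`, compactly supported in any given strip, with `-Δφ < μ φ / δ²` where
`φ > 0` (`exists_strict_subsolution`). Testing a super-harmonic `h ≥ 0` against `φ` and moving both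
derivatives to `φ` yields `∫ h (Δφ + μ φ / δ²) ≤ 0`, so `h = 0` on `{φ > 0}`. No Hardy
inequality is used. For a solution in all of `Ω` the zero set spreads: test functions that are
strictly subharmonic outside a small ball show that a zero of `h` near the centre of a ball
extends to the whole ball (`IsSuperharmonic.eq_zero_on_ball`), and `Ω` is connected.

*Existence for `μ ≤ 1/4`.* The barrier is `√δ - δ`. Since `∂Ω` is `C²` and compact, nearest boundary
points have exterior balls of a common radius `R`, so `δ` is touched from above at each point `x`
by the distance to such a ball: `δ(x + v) ≤ δ(x) + ⟪e, v⟫ + |v|² / (2R)` with `|e| = 1`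
(`exists_bdist_add_le`). As `√t - t` is increasing for small `t`, this bounds the second
differences of the barrier by those of an explicit function, and the unit slope produces the
Hardy term (`exists_barrier_second_difference`). The bound passes to mollifications, where it is
a pointwise bound for the Laplacian, and from there to test functions in `H¹_c`
(`integral_inner_gradient_ge`). Neither the regularity of `δ` nor the identity `|∇δ| = 1` is needed.
-/

open MeasureTheory
open scoped ContDiff

namespace HardyPotential

open scoped Laplacian
open Set

/-! ### One-dimensional profiles -/

lemma hasDerivAt_expNegInvGlue (x : ℝ) :
    HasDerivAt expNegInvGlue (x⁻¹ ^ 2 * expNegInvGlue x) x := by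
  simpa using expNegInvGlue.hasDerivAt_polynomial_eval_inv_mul 1 x

lemma hasDerivAt_deriv_expNegInvGlue (x : ℝ) :
    HasDerivAt (fun x => x⁻¹ ^ 2 * expNegInvGlue x)
      ((x⁻¹ ^ 4 - 2 * x⁻¹ ^ 3) * expNegInvGlue x) x := by
  have h := expNegInvGlue.hasDerivAt_polynomial_eval_inv_mul (Polynomial.X ^ 2) x
  simp only [Polynomial.eval_pow, Polynomial.eval_X, Polynomial.derivative_X_pow,
    Polynomial.eval_mul, Polynomial.eval_sub] at h
  convert h using 1
  rw [Polynomial.eval_C]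
  push_cast
  ring

/-- The second derivative of `s ↦ expNegInvGlue (α + β s + γ s²)`. -/
lemma deriv_deriv_expNegInvGlue_quadratic (α β γ s : ℝ) :
    deriv (deriv (fun s => expNegInvGlue (α + β * s + γ * s ^ 2))) s =
      (((α + β * s + γ * s ^ 2)⁻¹ ^ 4 - 2 * (α + β * s + γ * s ^ 2)⁻¹ ^ 3) * (β + 2 * γ * s) ^ 2
        + (α + β * s + γ * s ^ 2)⁻¹ ^ 2 * (2 * γ)) * expNegInvGlue (α + β * s + γ * s ^ 2) := by
  have hq : ∀ s, HasDerivAt (fun s => α + β * s + γ * s ^ 2) (β + 2 * γ * s) s := fun s => by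
    have := (((hasDerivAt_id s).const_mul β).const_add α).add ((hasDerivAt_pow 2 s).const_mul γ)
    refine this.congr_deriv ?_
    simp
    ring
  have hl : ∀ s, HasDerivAt (fun s => β + 2 * γ * s) (2 * γ) s := fun s => by
    simpa using ((hasDerivAt_id s).const_mul (2 * γ)).const_add β
  have h1 : deriv (fun s => expNegInvGlue (α + β * s + γ * s ^ 2)) = fun s =>
      ((α + β * s + γ * s ^ 2)⁻¹ ^ 2 * expNegInvGlue (α + β * s + γ * s ^ 2)) *
        (β + 2 * γ * s) := by
    funext s
    exact ((hasDerivAt_expNegInvGlue _).comp s (hq s)).deriv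
  rw [h1]
  have h2 := ((hasDerivAt_deriv_expNegInvGlue _).comp s (hq s)).mul (hl s)
  rw [show (fun s => ((α + β * s + γ * s ^ 2)⁻¹ ^ 2 * expNegInvGlue (α + β * s + γ * s ^ 2)) *
        (β + 2 * γ * s)) = ((fun x => x⁻¹ ^ 2 * expNegInvGlue x) ∘
          fun s => α + β * s + γ * s ^ 2) * fun s => β + 2 * γ * s from rfl, h2.deriv]
  simp only [Function.comp_apply]
  ring

/-- A smooth even bump on `ℝ`, positive exactly on `(-1, 1)`. With this choice of the decay at
`±1`, the quotient `bump'' / bump` tends to `+∞` there and is bounded below on `(-1, 1)`; see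
`bump_deriv_deriv_ge`. -/
noncomputable def bump (s : ℝ) : ℝ := expNegInvGlue (1 - s ^ 2)

lemma bump_contDiff : ContDiff ℝ ∞ bump :=
  expNegInvGlue.contDiff.comp (by fun_prop : ContDiff ℝ ∞ fun s : ℝ => 1 - s ^ 2)

lemma bump_nonneg (s : ℝ) : 0 ≤ bump s := expNegInvGlue.nonneg _

lemma bump_zero_pos : 0 < bump 0 := expNegInvGlue.pos_of_pos (by norm_num)

lemma bump_eq_zero {s : ℝ} (hs : 1 ≤ |s|) : bump s = 0 := by
  apply expNegInvGlue.zero_of_nonpos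
  nlinarith [sq_abs s]

lemma abs_lt_one_of_bump_ne_zero {s : ℝ} (hs : bump s ≠ 0) : |s| < 1 := by
  by_contra h
  exact hs (bump_eq_zero (not_lt.1 h))

lemma bump_deriv_deriv_ge (s : ℝ) : -(16 * bump s) ≤ deriv (deriv bump) s := by
  have h := deriv_deriv_expNegInvGlue_quadratic 1 0 (-1) s
  have e : (fun s : ℝ => expNegInvGlue (1 + 0 * s + -1 * s ^ 2)) = bump := by
    funext s; simp only [bump]; congr 1; ring
  have e' : (1 + 0 * s + -1 * s ^ 2) = 1 - s ^ 2 := by ring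
  rw [e, e'] at h
  rw [h, bump]
  rcases le_or_gt (1 - s ^ 2) 0 with hq | hq
  · simp [expNegInvGlue.zero_of_nonpos hq]
  · have hg := (expNegInvGlue.pos_of_pos hq).le
    rw [← neg_mul]
    refine mul_le_mul_of_nonneg_right ?_ hg
    set q := 1 - s ^ 2
    have hs : (0 + 2 * -1 * s) ^ 2 = 4 * (1 - q) := by simp only [q]; ring
    rw [hs]
    have hw : q⁻¹ * q = 1 := inv_mul_cancel₀ hq.ne'
    set w := q⁻¹
    have : (w ^ 4 - 2 * w ^ 3) * (4 * (1 - q)) + w ^ 2 * (2 * -1) =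
        4 * w ^ 4 - 12 * w ^ 3 + 6 * w ^ 2 := by
      linear_combination (-4 * w ^ 3 + 8 * w ^ 2) * hw
    rw [this]
    nlinarith [sq_nonneg (2 * w ^ 2 - 3 * w - 1), sq_nonneg (w - 2), sq_nonneg (w - 1)]

/-- The oscillating profile `√t z(log t / A)`: a compactly supported subsolution of the critical
one-dimensional Hardy equation, with an error `16 / A²` in the constant. -/
noncomputable def hardyProfile (A t : ℝ) : ℝ := √t * bump (A⁻¹ * Real.log t)

lemma hardyProfile_nonneg (A t : ℝ) : 0 ≤ hardyProfile A t :=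
  mul_nonneg (Real.sqrt_nonneg _) (bump_nonneg _)

lemma mem_Ioo_of_hardyProfile_ne_zero {A t : ℝ} (hA : 0 < A) (h : hardyProfile A t ≠ 0) :
    t ∈ Set.Ioo (Real.exp (-A)) (Real.exp A) := by
  have h1 : √t ≠ 0 := left_ne_zero_of_mul h
  have ht : 0 < t := by
    by_contra h'
    exact h1 (Real.sqrt_eq_zero_of_nonpos (not_lt.1 h'))
  have h2 := abs_lt_one_of_bump_ne_zero (right_ne_zero_of_mul h)
  rw [abs_mul, abs_inv, abs_of_pos hA, inv_mul_lt_one₀ hA, abs_lt] at h2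
  exact ⟨(Real.lt_log_iff_exp_lt ht).1 h2.1, (Real.log_lt_iff_lt_exp ht).1 h2.2⟩

lemma hardyProfile_one_pos {A : ℝ} : 0 < hardyProfile A 1 := by
  simp [hardyProfile, bump_zero_pos]

lemma hardyProfile_contDiff {A : ℝ} (hA : 0 < A) : ContDiff ℝ ∞ (hardyProfile A) := by
  rw [contDiff_iff_contDiffAt]
  intro t
  rcases lt_or_ge t (Real.exp (-A)) with ht | ht
  · have : hardyProfile A =ᶠ[nhds t] fun _ => 0 := by
      filter_upwards [gt_mem_nhds ht] with y hy
      by_contra h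
      exact absurd (mem_Ioo_of_hardyProfile_ne_zero hA h).1 (not_lt.2 (le_of_lt hy))
    exact contDiffAt_const.congr_of_eventuallyEq this
  · have ht0 : t ≠ 0 := ((Real.exp_pos _).trans_le ht).ne'
    exact (Real.contDiffAt_sqrt ht0).mul (bump_contDiff.contDiffAt.comp t
      (contDiffAt_const.mul (Real.contDiffAt_log.2 ht0)))

lemma hardyProfile_deriv_deriv_ge {A t : ℝ} (hA : 0 < A) :
    -((1 / 4 + 16 / A ^ 2) * hardyProfile A t / t ^ 2) ≤ deriv (deriv (hardyProfile A)) t := by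
  rcases lt_or_ge t (Real.exp (-A)) with ht | ht
  · have h0 : ∀ y < Real.exp (-A), hardyProfile A y = 0 := fun y hy => by
      by_contra h
      exact absurd (mem_Ioo_of_hardyProfile_ne_zero hA h).1 (not_lt.2 (le_of_lt hy))
    have : hardyProfile A =ᶠ[nhds t] fun _ => 0 := by
      filter_upwards [gt_mem_nhds ht] with y hy using h0 y hy
    rw [this.deriv.deriv_eq, h0 t ht]
    simp
  have ht0 : 0 < t := (Real.exp_pos _).trans_le ht
  have hz : ∀ s, HasDerivAt bump (deriv bump s) s := fun s =>
    (bump_contDiff.differentiable (by simp)).differentiableAt.hasDerivAt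
  have hz' : ∀ s, HasDerivAt (deriv bump) (deriv (deriv bump) s) s := fun s =>
    (((contDiff_infty_iff_deriv.1 bump_contDiff).2).differentiable
      (by simp)).differentiableAt.hasDerivAt
  have hlog : ∀ t : ℝ, 0 < t → HasDerivAt (fun t => A⁻¹ * Real.log t) (A⁻¹ * t⁻¹) t :=
    fun t ht => (Real.hasDerivAt_log ht.ne').const_mul _
  have h1 : ∀ t : ℝ, 0 < t → HasDerivAt (hardyProfile A)
      ((√t)⁻¹ * (bump (A⁻¹ * Real.log t) / 2 + A⁻¹ * deriv bump (A⁻¹ * Real.log t))) t := by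
    intro t ht
    have := (Real.hasDerivAt_sqrt ht.ne').mul ((hz _).comp t (hlog t ht))
    refine this.congr_deriv ?_
    have hs : √t ≠ 0 := (Real.sqrt_pos.2 ht).ne'
    have hs2 : t = √t ^ 2 := (Real.sq_sqrt ht.le).symm
    simp only [Function.comp_apply]
    have : √t * t⁻¹ = (√t)⁻¹ := by
      rw [hs2, Real.sqrt_sq (Real.sqrt_nonneg _)]; field_simp
    rw [show √t * (deriv bump (A⁻¹ * Real.log t) * (A⁻¹ * t⁻¹)) =
      (√t * t⁻¹) * A⁻¹ * deriv bump (A⁻¹ * Real.log t) by ring, this]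
    field_simp
  have h1' : deriv (hardyProfile A) =ᶠ[nhds t] fun t =>
      (√t)⁻¹ * (bump (A⁻¹ * Real.log t) / 2 + A⁻¹ * deriv bump (A⁻¹ * Real.log t)) := by
    filter_upwards [lt_mem_nhds ht0] with y hy using (h1 y hy).deriv
  have hs : 0 < √t := Real.sqrt_pos.2 ht0
  have h2 : HasDerivAt (fun t => (√t)⁻¹ *
      (bump (A⁻¹ * Real.log t) / 2 + A⁻¹ * deriv bump (A⁻¹ * Real.log t)))
      (√t / t ^ 2 * (-(bump (A⁻¹ * Real.log t) / 4) +
        deriv (deriv bump) (A⁻¹ * Real.log t) / A ^ 2)) t := by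
    have := ((Real.hasDerivAt_sqrt ht0.ne').inv hs.ne').mul
      ((((hz _).comp t (hlog t ht0)).div_const 2).add
        (((hz' _).comp t (hlog t ht0)).const_mul A⁻¹))
    refine this.congr_deriv ?_
    simp only [Function.comp_apply, Pi.inv_apply, Pi.add_apply]
    have hs2 : t = √t ^ 2 := (Real.sq_sqrt ht0.le).symm
    generalize bump (A⁻¹ * Real.log t) = a
    generalize deriv bump (A⁻¹ * Real.log t) = b
    generalize deriv (deriv bump) (A⁻¹ * Real.log t) = c
    set s := √t with hsd
    rw [hs2]
    field_simp
    ring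
  rw [h1'.deriv_eq, h2.deriv]
  have hb := bump_deriv_deriv_ge (A⁻¹ * Real.log t)
  have e : -((1 / 4 + 16 / A ^ 2) * hardyProfile A t / t ^ 2) = √t / t ^ 2 *
      (-(bump (A⁻¹ * Real.log t) / 4) + -(16 * bump (A⁻¹ * Real.log t)) / A ^ 2) := by
    rw [hardyProfile]; ring
  rw [e]
  gcongr

lemma deriv_deriv_comp_mul_left (f : ℝ → ℝ) (c t : ℝ) :
    deriv (deriv (fun t => f (c * t))) t = c ^ 2 * deriv (deriv f) (c * t) := by
  have h1 : deriv (fun t => f (c * t)) = fun t => c * deriv f (c * t) := by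
    funext t
    simpa using deriv_comp_mul_left c f t
  rw [h1, deriv_const_mul_field']
  simp only
  rw [deriv_comp_mul_left c (deriv f) t]
  simp
  ring

/-! ### The Laplacian along an orthonormal basis -/

section Laplacian

variable {ι E : Type*} [Fintype ι] [NormedAddCommGroup E] [InnerProductSpace ℝ E]

lemma hasDerivAt_along_line {f : E → ℝ} (hf : Differentiable ℝ f) (x v : E) (s : ℝ) :
    HasDerivAt (fun s : ℝ => f (x + s • v)) (fderiv ℝ f (x + s • v) v) s := by
  have h1 : HasDerivAt (fun s : ℝ => x + s • v) v s := by
    simpa using ((hasDerivAt_id s).smul_const v).const_add x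
  exact (hf (x + s • v)).hasFDerivAt.comp_hasDerivAt s h1

lemma deriv_deriv_along_line {f : E → ℝ} (hf : ContDiff ℝ 2 f) (x v : E) :
    deriv (deriv fun s : ℝ => f (x + s • v)) 0 = fderiv ℝ (fun y => fderiv ℝ f y v) x v := by
  have h1 : (deriv fun s : ℝ => f (x + s • v)) = fun s => fderiv ℝ f (x + s • v) v := by
    funext s
    exact (hasDerivAt_along_line (hf.differentiable (by simp)) x v s).deriv
  have hd : Differentiable ℝ fun y => fderiv ℝ f y v :=
    ((hf.fderiv_right (m := 1) (by norm_num)).clm_apply contDiff_const).differentiable (by simp)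
  rw [h1, (hasDerivAt_along_line hd x v 0).deriv]
  simp

variable [FiniteDimensional ℝ E]

lemma laplacian_eq_sum_fderiv (b : OrthonormalBasis ι ℝ E) {f : E → ℝ} (hf : ContDiff ℝ 2 f)
    (x : E) : (Δ f) x = ∑ i, fderiv ℝ (fun y => fderiv ℝ f y (b i)) x (b i) := by
  rw [InnerProductSpace.laplacian_eq_iteratedFDeriv_orthonormalBasis f b]
  refine Finset.sum_congr rfl fun i _ => ?_
  have hd : DifferentiableAt ℝ (fderiv ℝ f) x :=
    ((hf.fderiv_right (m := 1) (by norm_num)).differentiable (by simp)).differentiableAt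
  rw [iteratedFDeriv_two_apply, fderiv_clm_apply hd (by fun_prop)]
  simp

lemma laplacian_eq_sum_deriv (b : OrthonormalBasis ι ℝ E) {f : E → ℝ} (hf : ContDiff ℝ 2 f)
    (x : E) : (Δ f) x = ∑ i, deriv (deriv fun s : ℝ => f (x + s • b i)) 0 := by
  rw [laplacian_eq_sum_fderiv b hf]
  exact Finset.sum_congr rfl fun i _ => (deriv_deriv_along_line hf x (b i)).symm

lemma laplacian_continuous {f : E → ℝ} (hf : ContDiff ℝ 2 f) : Continuous (Δ f) := by
  have : Δ f = fun x => ∑ i, fderiv ℝ (fun y => fderiv ℝ f y (stdOrthonormalBasis ℝ E i)) x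
      (stdOrthonormalBasis ℝ E i) := funext fun x => laplacian_eq_sum_fderiv _ hf x
  rw [this]
  refine continuous_finsetSum _ fun i _ => ?_
  have hd : ContDiff ℝ 1 fun y => fderiv ℝ f y (stdOrthonormalBasis ℝ E i) :=
    (hf.fderiv_right (m := 1) (by norm_num)).clm_apply contDiff_const
  exact (hd.continuous_fderiv (by simp)).clm_apply continuous_const

lemma laplacian_eq_zero_of_notMem_tsupport {f : E → ℝ} (hf : ContDiff ℝ 2 f) {x : E}
    (hx : x ∉ tsupport f) : (Δ f) x = 0 := by
  rw [laplacian_eq_sum_fderiv (stdOrthonormalBasis ℝ E) hf]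
  refine Finset.sum_eq_zero fun i _ => ?_
  have h0 : (fun y => fderiv ℝ f y (stdOrthonormalBasis ℝ E i)) =ᶠ[nhds x] fun _ => 0 := by
    filter_upwards [(notMem_tsupport_iff_eventuallyEq.1 hx).fderiv (𝕜 := ℝ)] with y hy
    rw [hy]; simp
  rw [h0.fderiv_eq]
  simp

end Laplacian

/-! ### Testing the weak formulation with smooth functions -/

section Testing

variable {N : ℕ} {G Ω : Set (EuclideanSpace ℝ (Fin N))} {μ : ℝ}
  {h φ : EuclideanSpace ℝ (Fin N) → ℝ}
  {Dh : EuclideanSpace ℝ (Fin N) → EuclideanSpace ℝ (Fin N)}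

lemma integrableOn_mul_of_eq_zero {u ψ : EuclideanSpace ℝ (Fin N) → ℝ} (hG : IsOpen G)
    (hu : LocallyIntegrableOn u G volume) (hψ : Continuous ψ)
    {K : Set (EuclideanSpace ℝ (Fin N))} (hK : IsCompact K) (hKG : K ⊆ G)
    (h0 : ∀ x, x ∉ K → ψ x = 0) : IntegrableOn (fun x => u x * ψ x) G volume := by
  have h1 : IntegrableOn (fun x => u x * ψ x) K volume :=
    (hu.integrableOn_compact_subset hKG hK).mul_continuousOn hψ.continuousOn hK
  refine h1.of_forall_sdiff_eq_zero hG.measurableSet fun x hx => ?_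
  rw [h0 x hx.2, mul_zero]

lemma locallyIntegrableOn_inner {g : EuclideanSpace ℝ (Fin N) → EuclideanSpace ℝ (Fin N)}
    (hg : LocallyIntegrableOn g G volume) (v : EuclideanSpace ℝ (Fin N)) :
    LocallyIntegrableOn (fun x => inner ℝ (g x) v) G volume := fun x hx => by
  obtain ⟨t, ht, hint⟩ := hg x hx
  exact ⟨t, ht, hint.inner_const v⟩

/-- Smooth compactly supported functions belong to `H¹_c`. -/
lemma isH1Compact_of_contDiff (hφ : ContDiff ℝ ∞ φ) (hc : HasCompactSupport φ)
    (hs : tsupport φ ⊆ G) : IsH1Compact G φ (gradient φ) := by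
  have hgrad : gradient φ = fun x => (InnerProductSpace.toDual ℝ _).symm (fderiv ℝ φ x) := rfl
  have hgc : Continuous (gradient φ) := by
    rw [hgrad]
    exact (LinearIsometryEquiv.continuous _).comp (hφ.continuous_fderiv (by simp))
  have hgs : HasCompactSupport (gradient φ) := by
    rw [hgrad]
    exact (hc.fderiv ℝ).comp_left (map_zero _)
  refine ⟨⟨?_, ?_, ?_⟩, ?_, ?_, ?_⟩
  · exact (hφ.continuous.locallyIntegrable).locallyIntegrableOn _
  · exact hgc.locallyIntegrable.locallyIntegrableOn _
  · intro ψ hψ hψc hψs v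
    have e0 : ∀ x, x ∉ tsupport ψ → ψ x = 0 := fun x => image_eq_zero_of_notMem_tsupport
    have e1 : ∀ x, x ∉ tsupport ψ → fderiv ℝ ψ x = 0 := fun x hx =>
      image_eq_zero_of_notMem_tsupport fun h' => hx (tsupport_fderiv_subset ℝ h')
    rw [setIntegral_eq_integral_of_forall_compl_eq_zero (fun x hx => by
        rw [e1 x fun h' => hx (hψs h')]; simp),
      setIntegral_eq_integral_of_forall_compl_eq_zero (fun x hx => by
        rw [e0 x fun h' => hx (hψs h')]; simp)]
    simp_rw [inner_gradient_left]
    have c1 : Continuous fun x => fderiv ℝ φ x v :=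
      (hφ.continuous_fderiv (by simp)).clm_apply continuous_const
    have c2 : Continuous fun x => fderiv ℝ ψ x v :=
      (hψ.continuous_fderiv (by simp)).clm_apply continuous_const
    refine integral_mul_fderiv_eq_neg_fderiv_mul_of_integrable ?_ ?_ ?_ ?_ ?_
    · exact (c1.mul hψ.continuous).integrable_of_hasCompactSupport hψc.mul_left
    · exact (hφ.continuous.mul c2).integrable_of_hasCompactSupport hc.mul_right
    · exact (hφ.continuous.mul hψ.continuous).integrable_of_hasCompactSupport hc.mul_right
    · exact fun x _ => (hφ.differentiable (by simp)).differentiableAt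
    · exact fun x _ => (hψ.differentiable (by simp)).differentiableAt
  · exact (hφ.continuous.memLp_of_hasCompactSupport hc).restrict _
  · exact (hgc.memLp_of_hasCompactSupport hgs).restrict _
  · exact ⟨tsupport φ, hs, hc, .of_forall fun x hx => image_eq_zero_of_notMem_tsupport hx⟩

/-- Integration by parts: both derivatives are moved to the smooth function. -/
lemma HasWeakGradient.integral_inner_gradient (hG : IsOpen G) (hh : HasWeakGradient G h Dh)
    (hφ : ContDiff ℝ ∞ φ) (hc : HasCompactSupport φ) (hs : tsupport φ ⊆ G) :
    ∫ x in G, inner ℝ (Dh x) (gradient φ x) = - ∫ x in G, h x * (Δ φ) x := by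
  let b := EuclideanSpace.basisFun (Fin N) ℝ
  have hφ2 : ContDiff ℝ 2 φ := hφ.of_le (by norm_cast)
  have hψ : ∀ i, ContDiff ℝ ∞ fun y => fderiv ℝ φ y (b i) := fun i =>
    (hφ.fderiv_right (m := ∞) (by norm_cast)).clm_apply contDiff_const
  have hψs : ∀ i, tsupport (fun y => fderiv ℝ φ y (b i)) ⊆ tsupport φ := fun i =>
    tsupport_fderiv_apply_subset ℝ (b i)
  have hψc : ∀ i, HasCompactSupport fun y => fderiv ℝ φ y (b i) := fun i =>
    hc.fderiv_apply ℝ (b i)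
  have e1 : ∀ x, inner ℝ (Dh x) (gradient φ x) =
      ∑ i, inner ℝ (Dh x) (b i) * fderiv ℝ φ x (b i) := fun x => by
    rw [← b.sum_inner_mul_inner]
    refine Finset.sum_congr rfl fun i _ => ?_
    rw [real_inner_comm (gradient φ x) (b i), inner_gradient_left]
  have e2 : ∀ x, h x * (Δ φ) x =
      ∑ i, h x * fderiv ℝ (fun y => fderiv ℝ φ y (b i)) x (b i) := fun x => by
    rw [laplacian_eq_sum_fderiv b hφ2, Finset.mul_sum]
  simp_rw [e1, e2]
  rw [integral_finsetSum, integral_finsetSum, ← Finset.sum_neg_distrib]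
  · refine Finset.sum_congr rfl fun i _ => ?_
    rw [hh.integral_eq _ (hψ i) (hψc i) ((hψs i).trans hs) (b i), neg_neg]
  · intro i _
    refine integrableOn_mul_of_eq_zero hG hh.locInt
      (((hψ i).continuous_fderiv (by simp)).clm_apply continuous_const) hc hs fun x hx => ?_
    refine image_eq_zero_of_notMem_tsupport
      (f := fun x => fderiv ℝ (fun y => fderiv ℝ φ y (b i)) x (b i)) fun h' => hx ?_
    exact hψs i (tsupport_fderiv_apply_subset ℝ (b i) h')
  · intro i _
    refine integrableOn_mul_of_eq_zero hG (locallyIntegrableOn_inner hh.locInt_grad _)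
      (hψ i).continuous hc hs fun x hx => ?_
    exact image_eq_zero_of_notMem_tsupport (f := fun x => fderiv ℝ φ x (b i))
      fun h' => hx (hψs i h')

lemma bdist_continuous : Continuous (bdist Ω) := Metric.continuous_infDist_pt _

/-- A super-harmonic cannot be tested against a strict subsolution: if `φ ≥ 0` is a smooth
compactly supported function with `h (Δφ + μφ/δ²) ≥ 0`, then this product vanishes identically. -/
lemma IsSuperharmonic.mul_laplacian_add_eq_zero (hG : IsOpen G) (hδ : ∀ x ∈ G, 0 < bdist Ω x)
    (hh : IsSuperharmonic Ω μ G h) (hφ : ContDiff ℝ ∞ φ) (hc : HasCompactSupport φ)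
    (hs : tsupport φ ⊆ G) (hφ0 : ∀ x, 0 ≤ φ x)
    (hpos : ∀ x ∈ G, 0 ≤ h x * ((Δ φ) x + μ / bdist Ω x ^ 2 * φ x)) :
    ∀ x ∈ G, h x * ((Δ φ) x + μ / bdist Ω x ^ 2 * φ x) = 0 := by
  obtain ⟨hcont, Dh, hH1, htest⟩ := hh
  have hφ2 : ContDiff ℝ 2 φ := hφ.of_le (by norm_cast)
  have h1 := htest φ (gradient φ) (isH1Compact_of_contDiff hφ hc hs) (.of_forall hφ0)
  rw [weakForm, hH1.weakGrad.integral_inner_gradient hG hφ hc hs] at h1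
  have hV : ContinuousOn (fun x => μ / bdist Ω x ^ 2) G :=
    continuousOn_const.div (bdist_continuous.pow 2).continuousOn
      fun x hx => (pow_pos (hδ x hx) 2).ne'
  have i1 : IntegrableOn (fun x => h x * (Δ φ) x) G volume :=
    integrableOn_mul_of_eq_zero hG (hcont.locallyIntegrableOn hG.measurableSet)
      (laplacian_continuous hφ2) hc hs fun x hx => laplacian_eq_zero_of_notMem_tsupport hφ2 hx
  have i2 : IntegrableOn (fun x => μ / bdist Ω x ^ 2 * h x * φ x) G volume :=
    integrableOn_mul_of_eq_zero hG ((hV.mul hcont).locallyIntegrableOn hG.measurableSet)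
      hφ.continuous hc hs fun x hx => image_eq_zero_of_notMem_tsupport hx
  have e : ∀ x, h x * ((Δ φ) x + μ / bdist Ω x ^ 2 * φ x) =
      h x * (Δ φ) x + μ / bdist Ω x ^ 2 * h x * φ x := fun x => by ring
  have h2 : ∫ x in G, h x * ((Δ φ) x + μ / bdist Ω x ^ 2 * φ x) ≤ 0 := by
    simp_rw [e]
    rw [integral_add i1 i2]
    linarith
  have i3 : IntegrableOn (fun x => h x * ((Δ φ) x + μ / bdist Ω x ^ 2 * φ x)) G volume := by
    simp_rw [e]
    exact i1.add i2
  have h3 : (fun x => h x * ((Δ φ) x + μ / bdist Ω x ^ 2 * φ x))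
      =ᵐ[volume.restrict G] fun _ => 0 := by
    refine (integral_eq_zero_iff_of_nonneg_ae ?_ i3).1 (le_antisymm h2 ?_)
    · exact (ae_restrict_iff' hG.measurableSet).2 (.of_forall hpos)
    · exact setIntegral_nonneg hG.measurableSet hpos
  have hco : ContinuousOn (fun x => h x * ((Δ φ) x + μ / bdist Ω x ^ 2 * φ x)) G :=
    hcont.mul ((laplacian_continuous hφ2).continuousOn.add (hV.mul hφ.continuous.continuousOn))
  exact Measure.eqOn_open_of_ae_eq h3 hG hco continuousOn_const

end Testing

/-! ### Test functions concentrated near a boundary point -/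

section ProductTest

variable {N : ℕ}

/-- The product of one-dimensional functions of the coordinates of `x - p` in the basis `b`. -/
noncomputable def coordProd (b : OrthonormalBasis (Fin N) ℝ (EuclideanSpace ℝ (Fin N)))
    (p : EuclideanSpace ℝ (Fin N)) (f : Fin N → ℝ → ℝ) (x : EuclideanSpace ℝ (Fin N)) : ℝ :=
  ∏ i, f i (inner ℝ (b i) (x - p))

variable (b : OrthonormalBasis (Fin N) ℝ (EuclideanSpace ℝ (Fin N)))
  (p : EuclideanSpace ℝ (Fin N)) {f : Fin N → ℝ → ℝ}

lemma coordProd_contDiff (hf : ∀ i, ContDiff ℝ ∞ (f i)) : ContDiff ℝ ∞ (coordProd b p f) :=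
  contDiff_prod fun i _ => (hf i).comp (contDiff_const.inner ℝ (contDiff_id.sub contDiff_const))

lemma coordProd_nonneg (hf : ∀ i t, 0 ≤ f i t) (x : EuclideanSpace ℝ (Fin N)) :
    0 ≤ coordProd b p f x := Finset.prod_nonneg fun i _ => hf i _

lemma laplacian_coordProd (hf : ∀ i, ContDiff ℝ ∞ (f i)) (x : EuclideanSpace ℝ (Fin N)) :
    (Δ (coordProd b p f)) x = ∑ i, deriv (deriv (f i)) (inner ℝ (b i) (x - p)) *
      ∏ j ∈ Finset.univ.erase i, f j (inner ℝ (b j) (x - p)) := by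
  rw [laplacian_eq_sum_deriv b ((coordProd_contDiff b p hf).of_le (by norm_cast))]
  refine Finset.sum_congr rfl fun i _ => ?_
  have e : (fun s : ℝ => coordProd b p f (x + s • b i)) = fun s =>
      f i (inner ℝ (b i) (x - p) + s) *
        ∏ j ∈ Finset.univ.erase i, f j (inner ℝ (b j) (x - p)) := by
    funext s
    rw [coordProd, ← Finset.mul_prod_erase _ _ (Finset.mem_univ i)]
    have hx : x + s • b i - p = (x - p) + s • b i := by abel
    congr 1
    · rw [hx, inner_add_right, inner_smul_right, b.inner_eq_one, mul_one]
    · refine Finset.prod_congr rfl fun j hj => ?_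
      rw [hx, inner_add_right, inner_smul_right, b.inner_eq_zero (Finset.ne_of_mem_erase hj),
        mul_zero, add_zero]
  rw [e]
  simp only [deriv_mul_const_field', deriv_mul_const_field, deriv_comp_const_add, add_zero]

/-- If each factor satisfies `fᵢ'' ≥ -cᵢ fᵢ`, then `Δ ≥ -∑ cᵢ` on the product. -/
lemma laplacian_coordProd_ge (hf : ∀ i, ContDiff ℝ ∞ (f i)) (hf0 : ∀ i t, 0 ≤ f i t)
    (c : Fin N → ℝ → ℝ) (hc : ∀ i t, -(c i t * f i t) ≤ deriv (deriv (f i)) t)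
    (x : EuclideanSpace ℝ (Fin N)) :
    -((∑ i, c i (inner ℝ (b i) (x - p))) * coordProd b p f x) ≤ (Δ (coordProd b p f)) x := by
  rw [laplacian_coordProd b p hf, Finset.sum_mul, ← Finset.sum_neg_distrib]
  refine Finset.sum_le_sum fun i _ => ?_
  rw [coordProd, ← Finset.mul_prod_erase _ _ (Finset.mem_univ i), ← mul_assoc, ← neg_mul]
  exact mul_le_mul_of_nonneg_right (hc i _) (Finset.prod_nonneg fun j _ => hf0 j _)

end ProductTest

section HardyTest

variable {N : ℕ}

/-- The factors of the test function of size `r`: the oscillating profile in the direction `i₀`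
(the inner normal), a bump of width `r L` in the tangential ones. -/
noncomputable def hardyFactor (i₀ : Fin N) (A L r : ℝ) (i : Fin N) (t : ℝ) : ℝ :=
  if i = i₀ then hardyProfile A (r⁻¹ * t) else bump ((r * L)⁻¹ * t)

variable {i₀ : Fin N} {A L r : ℝ}

lemma hardyFactor_contDiff (hA : 0 < A) (i : Fin N) :
    ContDiff ℝ ∞ (hardyFactor i₀ A L r i) := by
  unfold hardyFactor
  split_ifs
  · exact (hardyProfile_contDiff hA).comp (contDiff_const.mul contDiff_id)
  · exact bump_contDiff.comp (contDiff_const.mul contDiff_id)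

lemma hardyFactor_nonneg (i : Fin N) (t : ℝ) : 0 ≤ hardyFactor i₀ A L r i t := by
  unfold hardyFactor
  split_ifs
  · exact hardyProfile_nonneg _ _
  · exact bump_nonneg _

lemma hardyFactor_deriv_deriv_ge (hA : 0 < A) (i : Fin N) (t : ℝ) :
    -((if i = i₀ then (1 / 4 + 16 / A ^ 2) / t ^ 2 else 16 / (r * L) ^ 2) *
      hardyFactor i₀ A L r i t) ≤ deriv (deriv (hardyFactor i₀ A L r i)) t := by
  by_cases hi : i = i₀
  · have e : hardyFactor i₀ A L r i = fun t => hardyProfile A (r⁻¹ * t) := by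
      funext t; simp [hardyFactor, hi]
    rw [e, deriv_deriv_comp_mul_left, if_pos hi]
    refine le_trans (le_of_eq ?_)
      (mul_le_mul_of_nonneg_left (hardyProfile_deriv_deriv_ge (t := r⁻¹ * t) hA) (sq_nonneg r⁻¹))
    rcases eq_or_ne r 0 with rfl | hr
    · simp [hardyProfile]
    · rw [mul_pow]
      field_simp
  · have e : hardyFactor i₀ A L r i = fun t => bump ((r * L)⁻¹ * t) := by
      funext t; simp [hardyFactor, hi]
    rw [e, deriv_deriv_comp_mul_left, if_neg hi]
    refine le_trans (le_of_eq ?_)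
      (mul_le_mul_of_nonneg_left (bump_deriv_deriv_ge ((r * L)⁻¹ * t)) (sq_nonneg (r * L)⁻¹))
    rw [inv_pow]
    ring

variable (b : OrthonormalBasis (Fin N) ℝ (EuclideanSpace ℝ (Fin N)))
  (p : EuclideanSpace ℝ (Fin N))

/-- The box, in the coordinates of the basis `b` centred at `p`, that carries the test function. -/
def hardyBox (i₀ : Fin N) (A L r : ℝ) : Set (EuclideanSpace ℝ (Fin N)) :=
  {x | r * Real.exp (-A) ≤ inner ℝ (b i₀) (x - p) ∧ inner ℝ (b i₀) (x - p) ≤ r * Real.exp A ∧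
    ∀ i, i ≠ i₀ → |inner ℝ (b i) (x - p)| ≤ r * L}

lemma hardyBox_isClosed : IsClosed (hardyBox b p i₀ A L r) := by
  have hc : ∀ i, Continuous fun x => inner ℝ (b i) (x - p) := fun i => by fun_prop
  refine (isClosed_le continuous_const (hc i₀)).inter
    ((isClosed_le (hc i₀) continuous_const).inter ?_)
  have e : {x | ∀ i, i ≠ i₀ → |inner ℝ (b i) (x - p)| ≤ r * L} =
      ⋂ i, ⋂ (_ : i ≠ i₀), {x | |inner ℝ (b i) (x - p)| ≤ r * L} := by
    ext x
    simp
  change IsClosed {x | ∀ i, i ≠ i₀ → |inner ℝ (b i) (x - p)| ≤ r * L}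
  rw [e]
  exact isClosed_iInter fun i => isClosed_iInter fun _ =>
    isClosed_le (hc i).abs continuous_const

lemma norm_sub_le_of_mem_hardyBox (hr : 0 < r) (hL : 0 ≤ L) {x : EuclideanSpace ℝ (Fin N)}
    (hx : x ∈ hardyBox b p i₀ A L r) : ‖x - p‖ ≤ r * (Real.exp A + N * L) := by
  have h1 : ‖x - p‖ ≤ ∑ i, |inner ℝ (b i) (x - p)| := by
    conv_lhs => rw [← b.sum_repr' (x - p)]
    refine (norm_sum_le _ _).trans (le_of_eq (Finset.sum_congr rfl fun i _ => ?_))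
    rw [norm_smul, b.norm_eq_one, mul_one, Real.norm_eq_abs]
  have hpos : 0 ≤ inner ℝ (b i₀) (x - p) := le_trans (by positivity) hx.1
  rw [← Finset.add_sum_erase _ _ (Finset.mem_univ i₀), abs_of_nonneg hpos] at h1
  have h2 : ∑ i ∈ Finset.univ.erase i₀, |inner ℝ (b i) (x - p)| ≤
      ∑ i ∈ (Finset.univ : Finset (Fin N)).erase i₀, r * L :=
    Finset.sum_le_sum fun i hi => hx.2.2 i (Finset.ne_of_mem_erase hi)
  have h3 : ∑ i ∈ (Finset.univ : Finset (Fin N)).erase i₀, r * L ≤ N * (r * L) := by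
    rw [Finset.sum_const, nsmul_eq_mul]
    refine mul_le_mul_of_nonneg_right ?_ (by positivity)
    have := Finset.card_erase_le (s := (Finset.univ : Finset (Fin N))) (a := i₀)
    simp only [Finset.card_univ, Fintype.card_fin] at this
    exact_mod_cast this
  linarith [hx.2.1]

lemma mem_hardyBox_of_ne_zero (hA : 0 < A) (hL : 0 < L) (hr : 0 < r)
    {x : EuclideanSpace ℝ (Fin N)} (hx : coordProd b p (hardyFactor i₀ A L r) x ≠ 0) :
    x ∈ hardyBox b p i₀ A L r := by
  have h : ∀ i, hardyFactor i₀ A L r i (inner ℝ (b i) (x - p)) ≠ 0 := fun i =>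
    Finset.prod_ne_zero_iff.1 hx i (Finset.mem_univ i)
  have h0 := h i₀
  simp only [hardyFactor, if_true] at h0
  have h1 := mem_Ioo_of_hardyProfile_ne_zero hA h0
  rw [mem_Ioo, ← div_eq_inv_mul, lt_div_iff₀ hr, div_lt_iff₀ hr] at h1
  refine ⟨by linarith [h1.1], by linarith [h1.2], fun i hi => ?_⟩
  have h2 := h i
  simp only [hardyFactor, if_neg hi] at h2
  have h3 := abs_lt_one_of_bump_ne_zero h2
  rw [abs_mul, abs_inv, abs_of_pos (mul_pos hr hL), inv_mul_lt_one₀ (mul_pos hr hL)] at h3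
  exact h3.le

lemma tsupport_hardyTest_subset (hA : 0 < A) (hL : 0 < L) (hr : 0 < r) :
    tsupport (coordProd b p (hardyFactor i₀ A L r)) ⊆ hardyBox b p i₀ A L r :=
  closure_minimal (fun _ hx => mem_hardyBox_of_ne_zero b p hA hL hr hx) (hardyBox_isClosed b p)

lemma hasCompactSupport_hardyTest (hA : 0 < A) (hL : 0 < L) (hr : 0 < r) :
    HasCompactSupport (coordProd b p (hardyFactor i₀ A L r)) := by
  refine HasCompactSupport.of_support_subset_isCompact
    (isCompact_closedBall p (r * (Real.exp A + N * L))) fun x hx => ?_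
  rw [Metric.mem_closedBall, dist_eq_norm]
  exact norm_sub_le_of_mem_hardyBox b p hr hL.le (mem_hardyBox_of_ne_zero b p hA hL hr hx)

lemma hardyTest_pos_at (hr : 0 < r) :
    0 < coordProd b p (hardyFactor i₀ A L r) (p + r • b i₀) := by
  refine Finset.prod_pos fun i _ => ?_
  rw [add_sub_cancel_left, inner_smul_right]
  by_cases hi : i = i₀
  · subst hi
    simp [hardyFactor, hr.ne', hardyProfile_one_pos]
  · rw [b.inner_eq_zero hi]
    simp [hardyFactor, hi, bump_zero_pos]

/-- The test function is a subsolution of `-Δ - (1/4 + 2κ) / t²`, with `t` the normal coordinate,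
once the profile is long (`16 / A² ≤ κ`) and its tangential width large compared with its
normal one. -/
lemma laplacian_hardyTest_ge {κ : ℝ} (hA : 0 < A) (hr : 0 < r) (hL : 0 < L)
    (hAκ : 16 / A ^ 2 ≤ κ) (hLκ : N * (16 * Real.exp A ^ 2 / L ^ 2) ≤ κ)
    (x : EuclideanSpace ℝ (Fin N)) :
    -((1 / 4 + 2 * κ) / (inner ℝ (b i₀) (x - p)) ^ 2 *
      coordProd b p (hardyFactor i₀ A L r) x) ≤
      (Δ (coordProd b p (hardyFactor i₀ A L r))) x := by
  refine le_trans ?_ (laplacian_coordProd_ge b p (hardyFactor_contDiff hA) hardyFactor_nonneg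
    (fun i t => if i = i₀ then (1 / 4 + 16 / A ^ 2) / t ^ 2 else 16 / (r * L) ^ 2)
    (hardyFactor_deriv_deriv_ge hA) x)
  rw [neg_le_neg_iff]
  by_cases h0 : coordProd b p (hardyFactor i₀ A L r) x = 0
  · simp [h0]
  refine mul_le_mul_of_nonneg_right ?_ (coordProd_nonneg b p hardyFactor_nonneg x)
  have hx := mem_hardyBox_of_ne_zero b p hA hL hr h0
  set t := inner ℝ (b i₀) (x - p) with ht
  have ht0 : 0 < t := lt_of_lt_of_le (by positivity) hx.1
  rw [← Finset.add_sum_erase _ _ (Finset.mem_univ i₀), if_pos rfl]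
  have h2 : ∑ i ∈ Finset.univ.erase i₀, (if i = i₀ then
      (1 / 4 + 16 / A ^ 2) / (inner ℝ (b i) (x - p)) ^ 2 else 16 / (r * L) ^ 2) ≤
      N * (16 / (r * L) ^ 2) := by
    rw [Finset.sum_congr rfl fun i hi => if_neg (Finset.ne_of_mem_erase hi), Finset.sum_const,
      nsmul_eq_mul]
    refine mul_le_mul_of_nonneg_right ?_ (by positivity)
    have := Finset.card_erase_le (s := (Finset.univ : Finset (Fin N))) (a := i₀)
    simp only [Finset.card_univ, Fintype.card_fin] at this
    exact_mod_cast this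
  have h3 : N * (16 / (r * L) ^ 2) ≤ κ / t ^ 2 := by
    rw [le_div_iff₀ (by positivity)]
    refine le_trans ?_ hLκ
    have : t ^ 2 ≤ (r * Real.exp A) ^ 2 := pow_le_pow_left₀ ht0.le hx.2.1 2
    calc N * (16 / (r * L) ^ 2) * t ^ 2 ≤ N * (16 / (r * L) ^ 2) * (r * Real.exp A) ^ 2 := by
          gcongr
      _ = N * (16 * Real.exp A ^ 2 / L ^ 2) := by field_simp
  have h4 : (1 / 4 + 16 / A ^ 2) / t ^ 2 ≤ (1 / 4 + κ) / t ^ 2 := by gcongr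
  have h5 : (1 / 4 + κ) / t ^ 2 + κ / t ^ 2 = (1 / 4 + 2 * κ) / t ^ 2 := by ring
  linarith

end HardyTest

/-! ### The distance to the boundary and defining functions -/

section Geometry

variable {N : ℕ} {Ω : Set (EuclideanSpace ℝ (Fin N))}

lemma bdist_pos (hΩ : IsOpen Ω) (hne : (frontier Ω).Nonempty) {x : EuclideanSpace ℝ (Fin N)}
    (hx : x ∈ Ω) : 0 < bdist Ω x := by
  refine (isClosed_frontier.notMem_iff_infDist_pos hne).1 fun h => ?_
  exact (hΩ.frontier_eq ▸ h).2 hx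

lemma strip_isOpen (hΩ : IsOpen Ω) (ρ : ℝ) : IsOpen (strip Ω ρ) :=
  hΩ.inter (isOpen_lt bdist_continuous continuous_const)

lemma IsBoundedC2Domain.frontier_nonempty (hN : 0 < N) (hΩ : IsBoundedC2Domain Ω) :
    (frontier Ω).Nonempty := by
  have : Nonempty (Fin N) := ⟨⟨0, hN⟩⟩
  refine nonempty_frontier_iff.2 ⟨hΩ.isConnected.nonempty, fun h => ?_⟩
  exact NormedSpace.unbounded_univ ℝ (EuclideanSpace ℝ (Fin N)) (h ▸ hΩ.isBounded)

lemma bdist_le_dist_of_notMem (hΩ : IsOpen Ω) {x y : EuclideanSpace ℝ (Fin N)} (hx : x ∈ Ω)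
    (hy : y ∉ Ω) : bdist Ω x ≤ dist x y := by
  have hmeet : ∃ z ∈ segment ℝ x y, z ∈ frontier Ω := by
    by_contra! hcon
    by_cases hy' : y ∈ closure Ω
    · exact hcon y (right_mem_segment ℝ x y) (hΩ.frontier_eq ▸ ⟨hy', hy⟩)
    have hpre : IsPreconnected (segment ℝ x y) := (convex_segment x y).isPreconnected
    obtain ⟨z, _, hz1, hz2⟩ := hpre Ω (closure Ω)ᶜ hΩ isClosed_closure.isOpen_compl
      (fun z hz => by
        by_cases hzΩ : z ∈ Ω
        · exact Or.inl hzΩ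
        · exact Or.inr fun hzc => hcon z hz (hΩ.frontier_eq ▸ ⟨hzc, hzΩ⟩))
      ⟨x, left_mem_segment ℝ x y, hx⟩ ⟨y, right_mem_segment ℝ x y, hy'⟩
    exact hz2 (subset_closure hz1)
  obtain ⟨z, hz, hzf⟩ := hmeet
  refine (Metric.infDist_le_dist_of_mem hzf).trans ?_
  have := dist_add_dist_of_mem_segment hz
  linarith [dist_nonneg (x := z) (y := y)]

/-- A defining function vanishes on the boundary. -/
lemma defining_eq_zero (hΩ : IsOpen Ω) {U : Set (EuclideanSpace ℝ (Fin N))} (hU : IsOpen U)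
    {f : EuclideanSpace ℝ (Fin N) → ℝ} (hf : ContinuousOn f U)
    (hfU : Ω ∩ U = {x | x ∈ U ∧ f x < 0}) {y : EuclideanSpace ℝ (Fin N)} (hyU : y ∈ U)
    (hy : y ∈ frontier Ω) : f y = 0 := by
  rw [hΩ.frontier_eq] at hy
  refine le_antisymm ?_ ?_
  · by_contra! hpos
    have h1 : ∀ᶠ z in nhds y, 0 < f z :=
      (hf.continuousAt (hU.mem_nhds hyU)).eventually (lt_mem_nhds hpos)
    obtain ⟨z, ⟨hz1, hzU⟩, hzΩ⟩ := mem_closure_iff_nhds.1 hy.1 _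
      (h1.and (hU.mem_nhds hyU))
    have : z ∈ {x | x ∈ U ∧ f x < 0} := hfU ▸ ⟨hzΩ, hzU⟩
    exact absurd hz1 (not_lt.2 this.2.le)
  · by_contra! hneg
    have : y ∈ Ω ∩ U := hfU ▸ ⟨hyU, hneg⟩
    exact hy.2 this.1

end Geometry

/-! ### Oscillation near the boundary for `μ > 1/4` -/

section Oscillation

variable {N : ℕ} {Ω : Set (EuclideanSpace ℝ (Fin N))} {μ ρ : ℝ}
  {h : EuclideanSpace ℝ (Fin N) → ℝ}

/-- Blow-up at a boundary point: at a small scale, `Ω` lies between cones close to the half-space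
`{⟪ν, x - p⟫ > 0}`, so that there `δ ≤ (1 + ε) ⟪ν, x - p⟫`. -/
lemma exists_inner_normal (hΩ : IsBoundedC2Domain Ω) {p : EuclideanSpace ℝ (Fin N)}
    (hp : p ∈ frontier Ω) : ∃ ν : EuclideanSpace ℝ (Fin N), ‖ν‖ = 1 ∧
      ∀ M > 0, ∀ ε > 0, ∃ d > 0, ∀ x, x ≠ p → dist x p < d → ‖x - p‖ ≤ M * inner ℝ ν (x - p) →
        x ∈ Ω ∧ bdist Ω x ≤ (1 + ε) * inner ℝ ν (x - p) := by
  obtain ⟨U, hU, hpU, f, hf, hdf, hfU⟩ := hΩ.boundary p hp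
  have hfp : f p = 0 := defining_eq_zero hΩ.isOpen hU hf.continuousOn hfU hpU hp
  have hdiff : DifferentiableAt ℝ f p :=
    (hf.differentiableOn (by simp)).differentiableAt (hU.mem_nhds hpU)
  have ha : gradient f p ≠ 0 := fun h0 => hdf p hpU (by
    ext v
    rw [← inner_gradient_left, h0, inner_zero_left]; rfl)
  set a := gradient f p with ha_def
  have hm : 0 < ‖a‖ := norm_pos_iff.2 ha
  refine ⟨-(‖a‖⁻¹ • a), ?_, fun M hM ε hε => ?_⟩
  · rw [norm_neg, norm_smul, norm_inv, norm_norm, inv_mul_cancel₀ hm.ne']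
  set ν := -(‖a‖⁻¹ • a) with hν
  have hν1 : ‖ν‖ = 1 := by rw [norm_neg, norm_smul, norm_inv, norm_norm, inv_mul_cancel₀ hm.ne']
  have hav : ∀ w, fderiv ℝ f p w = -(‖a‖ * inner ℝ ν w) := fun w => by
    rw [← inner_gradient_left, ← ha_def, hν, inner_neg_left, real_inner_smul_left]
    field_simp
  -- the error allowed in the first-order expansion of `f` at `p`
  set η := ‖a‖ * min 1 ε / (2 * (M + 1 + ε)) with hη
  have hη0 : 0 < η := by positivity
  have hexp := hdiff.hasFDerivAt.isLittleO.def hη0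
  rw [Filter.Eventually, Metric.mem_nhds_iff] at hexp
  obtain ⟨d₁, hd₁, hexp⟩ := hexp
  obtain ⟨d₂, hd₂, hdU⟩ := Metric.isOpen_iff.1 hU p hpU
  have key : ∀ w : EuclideanSpace ℝ (Fin N), ‖w‖ < min d₁ d₂ →
      p + w ∈ U ∧ |f (p + w) + ‖a‖ * inner ℝ ν w| ≤ η * ‖w‖ := fun w hw => by
    have hw' : dist (p + w) p = ‖w‖ := by rw [dist_eq_norm, add_sub_cancel_left]
    refine ⟨hdU (by rw [Metric.mem_ball, hw']; exact hw.trans_le (min_le_right _ _)), ?_⟩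
    have := hexp (show p + w ∈ Metric.ball p d₁ by
      rw [Metric.mem_ball, hw']; exact hw.trans_le (min_le_left _ _))
    simp only [mem_ofPred_eq, add_sub_cancel_left, hfp, hav, sub_zero, sub_neg_eq_add,
      Real.norm_eq_abs] at this
    exact this
  have hMpos : 0 < M + 1 + ε := by positivity
  have hηM : η * (M + 1 + ε) = ‖a‖ * min 1 ε / 2 := by
    rw [hη]; field_simp
  refine ⟨min d₁ d₂ / (M + 1 + ε) / (M + 1 + ε), by positivity, fun x hxp hxd hcone => ?_⟩
  set w := x - p with hw
  have hxw : x = p + w := by rw [hw]; abel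
  set t := inner ℝ ν w with ht
  have hw0 : 0 < ‖w‖ := norm_pos_iff.2 (sub_ne_zero.2 hxp)
  have ht0 : 0 < t := by
    by_contra! h'
    nlinarith
  have htw : t ≤ ‖w‖ := by
    have := real_inner_le_norm ν w
    rwa [hν1, one_mul] at this
  rw [dist_eq_norm, ← hw] at hxd
  have hM1 : 1 ≤ M := by
    by_contra! h'
    nlinarith
  have hbig : (M + 1 + ε) * ‖w‖ < min d₁ d₂ := by
    rw [div_div, lt_div_iff₀ (by positivity)] at hxd
    refine lt_of_le_of_lt ?_ hxd
    rw [mul_comm ‖w‖, mul_assoc]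
    refine le_mul_of_one_le_left (by positivity) (by linarith)
  have hsmall : ‖w‖ < min d₁ d₂ :=
    (le_mul_of_one_le_left hw0.le (by linarith : 1 ≤ M + 1 + ε)).trans_lt hbig
  have hwt : ‖w‖ ≤ (M + 1 + ε) * t := by
    have : 0 ≤ (1 + ε) * t := by positivity
    linarith
  have hxΩ : x ∈ Ω := by
    obtain ⟨hU1, h1⟩ := key w hsmall
    have h2 := (abs_le.1 h1).2
    have h3 : η * ‖w‖ ≤ η * ((M + 1 + ε) * t) := by gcongr
    have h4 : ‖a‖ * min 1 ε / 2 * t ≤ ‖a‖ * 1 / 2 * t := by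
      gcongr
      exact min_le_left 1 ε
    have h5 : f (p + w) < 0 := by
      have : η * ((M + 1 + ε) * t) = ‖a‖ * min 1 ε / 2 * t := by rw [← mul_assoc, hηM]
      linarith [mul_pos hm ht0]
    have : p + w ∈ Ω ∩ U := hfU ▸ ⟨hU1, h5⟩
    rw [hxw]
    exact this.1
  refine ⟨hxΩ, ?_⟩
  -- the point below `x` at normal height `-ε t` lies outside `Ω`
  set w' := w - ((1 + ε) * t) • ν with hw'
  have hww' : ‖w - w'‖ = (1 + ε) * t := by
    rw [hw', sub_sub_cancel, norm_smul, hν1, mul_one, Real.norm_eq_abs, abs_of_pos (by positivity)]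
  have hw'n : ‖w'‖ ≤ ‖w‖ + (1 + ε) * t := by
    have := norm_sub_le w (((1 + ε) * t) • ν)
    rwa [norm_smul, hν1, mul_one, Real.norm_eq_abs, abs_of_pos (by positivity)] at this
  have hw't : ‖w'‖ ≤ (M + 1 + ε) * t := by linarith
  have hw's : ‖w'‖ < min d₁ d₂ :=
    (hw't.trans (mul_le_mul_of_nonneg_left htw hMpos.le)).trans_lt hbig
  have hin : inner ℝ ν w' = -(ε * t) := by
    rw [hw', inner_sub_right, real_inner_smul_right, real_inner_self_eq_norm_sq, hν1, ← ht]
    ring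
  have hout : p + w' ∉ Ω := by
    obtain ⟨hU1, h1⟩ := key w' hw's
    rw [hin] at h1
    have h2 := (abs_le.1 h1).1
    have h3 : η * ‖w'‖ ≤ η * ((M + 1 + ε) * t) := by gcongr
    have h4 : ‖a‖ * min 1 ε / 2 * t ≤ ‖a‖ * ε / 2 * t := by
      gcongr
      exact min_le_right 1 ε
    have h5 : 0 < f (p + w') := by
      have : η * ((M + 1 + ε) * t) = ‖a‖ * min 1 ε / 2 * t := by rw [← mul_assoc, hηM]
      linarith [mul_pos (mul_pos hm hε) ht0]
    intro hmem
    have : p + w' ∈ {x | x ∈ U ∧ f x < 0} := hfU ▸ ⟨hmem, hU1⟩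
    exact absurd this.2 (not_lt.2 h5.le)
  have := bdist_le_dist_of_notMem hΩ.isOpen hxΩ hout
  rwa [dist_eq_norm, ← sub_sub, hww'] at this

/-- For `μ > 1/4` every boundary strip carries a smooth compactly supported strict subsolution. -/
lemma exists_strict_subsolution (hN : 0 < N) (hΩ : IsBoundedC2Domain Ω) (hμ : 1 / 4 < μ)
    (hρ : 0 < ρ) : ∃ φ : EuclideanSpace ℝ (Fin N) → ℝ, ContDiff ℝ ∞ φ ∧ HasCompactSupport φ ∧
      tsupport φ ⊆ strip Ω ρ ∧ (∀ x, 0 ≤ φ x) ∧ (∃ x, 0 < φ x) ∧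
      (∀ x, 0 ≤ (Δ φ) x + μ / bdist Ω x ^ 2 * φ x) ∧
      ∀ x, 0 < φ x → 0 < (Δ φ) x + μ / bdist Ω x ^ 2 * φ x := by
  have hne := hΩ.frontier_nonempty hN
  obtain ⟨p, hp⟩ := hne
  obtain ⟨ν, hν, hcone⟩ := exists_inner_normal hΩ hp
  let i₀ : Fin N := ⟨0, hN⟩
  obtain ⟨b, hb⟩ := Orthonormal.exists_orthonormalBasis_extension_of_card_eq (𝕜 := ℝ)
    (E := EuclideanSpace ℝ (Fin N)) (ι := Fin N) (by simp) (v := fun _ => ν) (s := {i₀}) (by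
      refine ⟨fun i => by simpa using hν, fun i j hij => ?_⟩
      exact absurd (Subsingleton.elim i j) hij)
  have hbi : b i₀ = ν := hb i₀ rfl
  set κ := (μ - 1 / 4) / 4 with hκ
  have hκ0 : 0 < κ := by rw [hκ]; linarith
  set A := 4 / √κ with hA
  have hsκ : 0 < √κ := Real.sqrt_pos.2 hκ0
  have hA0 : 0 < A := by positivity
  have hA2 : A ^ 2 = 16 / κ := by
    rw [hA, div_pow, Real.sq_sqrt hκ0.le]; norm_num
  have hAκ : 16 / A ^ 2 ≤ κ := by
    rw [hA2]; field_simp; rfl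
  set L := (N + 1) * A * Real.exp A with hL
  have hL0 : 0 < L := by positivity
  have hLκ : N * (16 * Real.exp A ^ 2 / L ^ 2) ≤ κ := by
    have : N * (16 * Real.exp A ^ 2 / L ^ 2) = (N / (N + 1) ^ 2 : ℝ) * κ := by
      rw [hL, mul_pow, mul_pow, hA2]
      field_simp
    rw [this]
    refine mul_le_of_le_one_left hκ0.le ?_
    rw [div_le_one (by positivity)]
    nlinarith [(Nat.cast_nonneg N : (0 : ℝ) ≤ N)]
  set ε := κ / (3 * (1 / 4 + 2 * κ)) with hε
  have hε0 : 0 < ε := by positivity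
  have hε1 : ε ≤ 1 := by
    rw [hε, div_le_one (by positivity)]
    linarith
  have hμε : (1 / 4 + 2 * κ) * (1 + ε) ^ 2 < μ := by
    have h1 : ε * (3 * (1 / 4 + 2 * κ)) = κ := by rw [hε]; field_simp
    have h2 : (1 + ε) ^ 2 ≤ 1 + 3 * ε := by nlinarith
    have h3 : μ = 1 / 4 + 4 * κ := by rw [hκ]; ring
    nlinarith
  set R := Real.exp A + N * L with hR
  have hR0 : 0 < R := by positivity
  obtain ⟨d, hd, hcone⟩ := hcone (R * Real.exp A) (by positivity) ε hε0
  obtain ⟨r, hr0, hrd, hrρ⟩ : ∃ r > 0, r * R < d ∧ r * R < ρ := by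
    refine ⟨min d ρ / (2 * R), by positivity, ?_, ?_⟩
    · have : min d ρ / (2 * R) * R = min d ρ / 2 := by field_simp
      rw [this]; linarith [min_le_left d ρ]
    · have : min d ρ / (2 * R) * R = min d ρ / 2 := by field_simp
      rw [this]; linarith [min_le_right d ρ]
  have hbox : ∀ x ∈ hardyBox b p i₀ A L r, 0 < inner ℝ (b i₀) (x - p) ∧ x ∈ strip Ω ρ ∧
      bdist Ω x ≤ (1 + ε) * inner ℝ (b i₀) (x - p) := fun x hx => by
    have hn := norm_sub_le_of_mem_hardyBox b p hr0 hL0.le hx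
    have ht0 : 0 < inner ℝ (b i₀) (x - p) := lt_of_lt_of_le (by positivity) hx.1
    have hxp : x ≠ p := fun h' => by simp [h'] at ht0
    have h1 := hcone x hxp (by rw [dist_eq_norm]; exact hn.trans_lt hrd) (by
      rw [← hbi]
      refine hn.trans ?_
      have := mul_le_mul_of_nonneg_left hx.1 (by positivity : 0 ≤ R * Real.exp A)
      refine le_trans (le_of_eq ?_) this
      have : Real.exp A * Real.exp (-A) = 1 := by rw [← Real.exp_add]; simp
      linear_combination (-(R * r)) * this)
    rw [← hbi] at h1
    refine ⟨ht0, ⟨h1.1, ?_⟩, h1.2⟩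
    refine lt_of_le_of_lt (Metric.infDist_le_dist_of_mem hp) ?_
    rw [dist_eq_norm]
    exact hn.trans_lt hrρ
  have hpos : ∀ x, 0 < coordProd b p (hardyFactor i₀ A L r) x →
      0 < (Δ (coordProd b p (hardyFactor i₀ A L r))) x +
        μ / bdist Ω x ^ 2 * coordProd b p (hardyFactor i₀ A L r) x := fun x hx => by
    obtain ⟨ht, hxs, hbd⟩ := hbox x (mem_hardyBox_of_ne_zero b p hA0 hL0 hr0 hx.ne')
    have h1 := laplacian_hardyTest_ge (i₀ := i₀) b p hA0 hr0 hL0 hAκ hLκ x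
    have hδ := bdist_pos hΩ.isOpen ⟨p, hp⟩ hxs.1
    set t := inner ℝ (b i₀) (x - p)
    have h2 : (1 / 4 + 2 * κ) / t ^ 2 < μ / bdist Ω x ^ 2 := by
      rw [div_lt_div_iff₀ (by positivity) (by positivity)]
      have : bdist Ω x ^ 2 ≤ ((1 + ε) * t) ^ 2 := pow_le_pow_left₀ hδ.le hbd 2
      calc (1 / 4 + 2 * κ) * bdist Ω x ^ 2 ≤ (1 / 4 + 2 * κ) * ((1 + ε) * t) ^ 2 := by gcongr
        _ = (1 / 4 + 2 * κ) * (1 + ε) ^ 2 * t ^ 2 := by ring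
        _ < μ * t ^ 2 := by gcongr
    have h3 := mul_lt_mul_of_pos_right h2 hx
    linarith
  refine ⟨coordProd b p (hardyFactor i₀ A L r),
    coordProd_contDiff b p (hardyFactor_contDiff hA0), hasCompactSupport_hardyTest b p hA0 hL0 hr0,
    (tsupport_hardyTest_subset b p hA0 hL0 hr0).trans fun x hx => (hbox x hx).2.1,
    coordProd_nonneg b p hardyFactor_nonneg, ⟨_, hardyTest_pos_at b p hr0⟩, fun x => ?_, hpos⟩
  rcases (coordProd_nonneg b p (hardyFactor_nonneg (i₀ := i₀) (A := A) (L := L) (r := r)) x).eq_or_lt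
    with h0 | h0
  · have h1 := laplacian_hardyTest_ge (i₀ := i₀) b p hA0 hr0 hL0 hAκ hLκ x
    rw [← h0] at h1 ⊢
    simpa using h1
  · exact (hpos x h0).le

/-- For `μ > 1/4` a nonnegative super-harmonic in a strip vanishes on a nonempty open set. -/
lemma IsSuperharmonic.exists_open_eq_zero (hN : 0 < N) (hΩ : IsBoundedC2Domain Ω)
    (hμ : 1 / 4 < μ) (hρ : 0 < ρ) {G : Set (EuclideanSpace ℝ (Fin N))} (hG : IsOpen G)
    (hGΩ : G ⊆ Ω) (hρG : strip Ω ρ ⊆ G) (hh : IsSuperharmonic Ω μ G h) (h0 : ∀ x ∈ G, 0 ≤ h x) :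
    ∃ O ⊆ strip Ω ρ, IsOpen O ∧ O.Nonempty ∧ ∀ x ∈ O, h x = 0 := by
  obtain ⟨φ, hφ, hc, hs, hφ0, hex, hle, hlt⟩ := exists_strict_subsolution hN hΩ hμ hρ
  have hz := hh.mul_laplacian_add_eq_zero hG
    (fun x hx => bdist_pos hΩ.isOpen (hΩ.frontier_nonempty hN) (hGΩ hx)) hφ hc (hs.trans hρG) hφ0
    fun x hx => mul_nonneg (h0 x hx) (hle x)
  refine ⟨{x | 0 < φ x}, fun x hx => hs (subset_tsupport _ (ne_of_gt hx)),
    isOpen_lt continuous_const hφ.continuous, hex, fun x hx => ?_⟩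
  have hxG : x ∈ G := hρG (hs (subset_tsupport _ (ne_of_gt hx)))
  exact (mul_eq_zero.1 (hz x hxG)).resolve_right (hlt x hx).ne'

end Oscillation

/-! ### Propagation of zeros -/

section Propagation

variable {N : ℕ} {Ω : Set (EuclideanSpace ℝ (Fin N))} {μ : ℝ}
  {h : EuclideanSpace ℝ (Fin N) → ℝ}

/-- A radial bump on the ball of radius `D` about `x₁`; it is strictly subharmonic outside a given
smaller ball when `c` is small, see `laplacian_radialBump_pos`. -/
noncomputable def radialBump (x₁ : EuclideanSpace ℝ (Fin N)) (c D : ℝ)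
    (x : EuclideanSpace ℝ (Fin N)) : ℝ := expNegInvGlue (c * (D ^ 2 - ‖x - x₁‖ ^ 2))

variable (x₁ : EuclideanSpace ℝ (Fin N)) {c D R : ℝ}

lemma radialBump_contDiff : ContDiff ℝ ∞ (radialBump x₁ c D) := by
  refine expNegInvGlue.contDiff.comp (contDiff_const.mul (contDiff_const.sub ?_))
  exact (contDiff_id.sub contDiff_const).norm_sq ℝ

lemma laplacian_radialBump (x : EuclideanSpace ℝ (Fin N)) :
    (Δ (radialBump x₁ c D)) x =
      (((c * (D ^ 2 - ‖x - x₁‖ ^ 2))⁻¹ ^ 4 - 2 * (c * (D ^ 2 - ‖x - x₁‖ ^ 2))⁻¹ ^ 3) *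
        (4 * c ^ 2 * ‖x - x₁‖ ^ 2) - 2 * c * N * (c * (D ^ 2 - ‖x - x₁‖ ^ 2))⁻¹ ^ 2) *
        radialBump x₁ c D x := by
  set b := EuclideanSpace.basisFun (Fin N) ℝ
  rw [laplacian_eq_sum_deriv b ((radialBump_contDiff x₁).of_le (by norm_cast))]
  have e : ∀ i, (fun s : ℝ => radialBump x₁ c D (x + s • b i)) = fun s =>
      expNegInvGlue (c * (D ^ 2 - ‖x - x₁‖ ^ 2) + (-2 * c * inner ℝ (x - x₁) (b i)) * s +
        (-c) * s ^ 2) := fun i => by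
    funext s
    rw [radialBump, show x + s • b i - x₁ = (x - x₁) + s • b i by abel, norm_add_sq_real,
      real_inner_smul_right, norm_smul, b.norm_eq_one, mul_one, Real.norm_eq_abs, sq_abs]
    congr 1
    ring
  simp_rw [e, deriv_deriv_expNegInvGlue_quadratic]
  simp only [mul_zero, add_zero, ne_eq, OfNat.ofNat_ne_zero, not_false_eq_true, zero_pow]
  rw [← Finset.sum_mul, Finset.sum_add_distrib, ← Finset.mul_sum]
  have hs : ∑ i, (-2 * c * inner ℝ (x - x₁) (b i)) ^ 2 = 4 * c ^ 2 * ‖x - x₁‖ ^ 2 := by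
    rw [← b.sum_sq_inner_left (x - x₁), Finset.mul_sum]
    exact Finset.sum_congr rfl fun i _ => by ring
  rw [hs, Finset.sum_const, Finset.card_univ, Fintype.card_fin, nsmul_eq_mul, radialBump]
  ring

lemma laplacian_radialBump_pos (hc : 0 < c) (hcD : c * D ^ 2 ≤ 1 / 4)
    (hcR : c * N * D ^ 4 < R ^ 2) (hR : 0 < R) {x : EuclideanSpace ℝ (Fin N)}
    (hx : R ≤ ‖x - x₁‖) (hxD : ‖x - x₁‖ < D) : 0 < (Δ (radialBump x₁ c D)) x := by
  rw [laplacian_radialBump]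
  have hn : 0 ≤ ‖x - x₁‖ := norm_nonneg _
  have hD2 : 0 < D ^ 2 - ‖x - x₁‖ ^ 2 := by nlinarith
  set q := c * (D ^ 2 - ‖x - x₁‖ ^ 2) with hq
  have hq0 : 0 < q := mul_pos hc hD2
  have hg : 0 < radialBump x₁ c D x := expNegInvGlue.pos_of_pos hq0
  refine mul_pos ?_ hg
  have hqD : q ≤ c * D ^ 2 := by rw [hq]; gcongr; nlinarith
  have hR2 : R ^ 2 ≤ ‖x - x₁‖ ^ 2 := by gcongr
  set n := ‖x - x₁‖
  have e : (q⁻¹ ^ 4 - 2 * q⁻¹ ^ 3) * (4 * c ^ 2 * n ^ 2) - 2 * c * N * q⁻¹ ^ 2 =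
      q⁻¹ ^ 4 * ((1 - 2 * q) * (4 * c ^ 2 * n ^ 2) - 2 * c * N * q ^ 2) := by
    field_simp
  rw [e]
  refine mul_pos (by positivity) ?_
  have h1 : 1 / 2 * (4 * c ^ 2 * R ^ 2) ≤ (1 - 2 * q) * (4 * c ^ 2 * n ^ 2) := by
    gcongr
    · linarith
    · linarith
  have h2 : 2 * c * N * q ^ 2 ≤ 2 * c * N * (c * D ^ 2) ^ 2 := by gcongr
  have h3 : 2 * c ^ 2 * (c * N * D ^ 4) < 2 * c ^ 2 * R ^ 2 := by gcongr
  nlinarith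

/-- If a nonnegative super-harmonic vanishes near the centre of a ball contained in `Ω`, then it
vanishes on the whole ball. -/
lemma IsSuperharmonic.eq_zero_on_ball (hΩ : IsOpen Ω) (hδ : ∀ x ∈ Ω, 0 < bdist Ω x) (hμ : 0 ≤ μ)
    (hh : IsSuperharmonic Ω μ Ω h) (h0 : ∀ x ∈ Ω, 0 ≤ h x) (hD : Metric.closedBall x₁ D ⊆ Ω)
    (hR : 0 < R) (hz : ∀ x ∈ Metric.ball x₁ R, h x = 0) :
    ∀ x ∈ Metric.ball x₁ D, h x = 0 := by
  intro x hx
  have hD0 : 0 < D := dist_nonneg.trans_lt hx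
  rcases lt_or_ge (dist x x₁) R with hxR | hxR
  · exact hz x hxR
  set c := min (1 / (4 * D ^ 2)) (R ^ 2 / (2 * (N + 1) * D ^ 4)) with hc
  have hc0 : 0 < c := by positivity
  have hcD : c * D ^ 2 ≤ 1 / 4 := by
    calc c * D ^ 2 ≤ 1 / (4 * D ^ 2) * D ^ 2 := by gcongr; exact min_le_left _ _
      _ = 1 / 4 := by field_simp
  have hcR : c * N * D ^ 4 < R ^ 2 := by
    calc c * N * D ^ 4 ≤ R ^ 2 / (2 * (N + 1) * D ^ 4) * (N + 1) * D ^ 4 := by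
          gcongr
          · exact min_le_right _ _
          · linarith
      _ = R ^ 2 / 2 := by field_simp
      _ < R ^ 2 := by nlinarith [sq_pos_of_pos hR]
  have hsupp : ∀ y, y ∉ Metric.ball x₁ D → radialBump x₁ c D y = 0 := fun y hy => by
    refine expNegInvGlue.zero_of_nonpos (mul_nonpos_of_nonneg_of_nonpos hc0.le ?_)
    rw [Metric.mem_ball, dist_eq_norm, not_lt] at hy
    nlinarith
  have hsub : Function.support (radialBump x₁ c D) ⊆ Metric.closedBall x₁ D := fun y hy => by
    by_contra h'
    exact hy (hsupp y fun h'' => h' (Metric.ball_subset_closedBall h''))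
  have hnn : ∀ y, 0 ≤ radialBump x₁ c D y := fun y => expNegInvGlue.nonneg _
  have hV : ∀ y, 0 ≤ μ / bdist Ω y ^ 2 * radialBump x₁ c D y := fun y =>
    mul_nonneg (div_nonneg hμ (sq_nonneg _)) (hnn y)
  have hmain := hh.mul_laplacian_add_eq_zero hΩ hδ (radialBump_contDiff x₁)
    (HasCompactSupport.of_support_subset_isCompact (isCompact_closedBall x₁ D) hsub)
    ((closure_minimal hsub Metric.isClosed_closedBall).trans hD) hnn (fun y hy => by
      rcases lt_or_ge (dist y x₁) R with hyR | hyR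
      · rw [hz y hyR, zero_mul]
      refine mul_nonneg (h0 y hy) ?_
      by_cases hyD : y ∈ Metric.ball x₁ D
      · rw [Metric.mem_ball, dist_eq_norm] at hyD
        rw [dist_eq_norm] at hyR
        exact add_nonneg (laplacian_radialBump_pos x₁ hc0 hcD hcR hR hyR hyD).le (hV y)
      · rw [laplacian_radialBump, hsupp y hyD]
        simp) x (hD (Metric.ball_subset_closedBall hx))
  refine (mul_eq_zero.1 hmain).resolve_right (ne_of_gt ?_)
  rw [dist_eq_norm] at hxR
  rw [Metric.mem_ball, dist_eq_norm] at hx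
  exact add_pos_of_pos_of_nonneg (laplacian_radialBump_pos x₁ hc0 hcD hcR hR hxR hx) (hV x)

/-- A nonnegative super-harmonic in the connected set `Ω` that vanishes on a nonempty open set
vanishes identically. -/
lemma IsSuperharmonic.eq_zero_of_open (hΩ : IsOpen Ω) (hconn : IsPreconnected Ω)
    (hδ : ∀ x ∈ Ω, 0 < bdist Ω x) (hμ : 0 ≤ μ) (hh : IsSuperharmonic Ω μ Ω h)
    (h0 : ∀ x ∈ Ω, 0 ≤ h x) {O : Set (EuclideanSpace ℝ (Fin N))} (hO : IsOpen O)
    (hOΩ : (Ω ∩ O).Nonempty) (hz : ∀ x ∈ O, h x = 0) : ∀ x ∈ Ω, h x = 0 := by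
  set W : Set (EuclideanSpace ℝ (Fin N)) := {x | ∀ᶠ y in nhds x, h y = 0} with hW
  have hWo : IsOpen W := isOpen_setOfPred_eventually_nhds
  have hsub : Ω ⊆ W := by
    refine hconn.subset_of_closure_inter_subset hWo ?_ ?_
    · obtain ⟨x, hxΩ, hxO⟩ := hOΩ
      refine ⟨x, hxΩ, ?_⟩
      filter_upwards [hO.mem_nhds hxO] with y hy using hz y hy
    · rintro y ⟨hyW, hyΩ⟩
      obtain ⟨ε, hε, hball⟩ := Metric.isOpen_iff.1 hΩ y hyΩ
      obtain ⟨x₁, hx₁, hdist⟩ := Metric.mem_closure_iff.1 hyW (ε / 3) (by positivity)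
      obtain ⟨R, hR, hzR⟩ := Metric.eventually_nhds_iff_ball.1 hx₁
      have hzero := hh.eq_zero_on_ball x₁ (D := ε / 2) hΩ hδ hμ h0 (fun z hz => hball ?_) hR hzR
      · have hy : y ∈ Metric.ball x₁ (ε / 2) := by rw [Metric.mem_ball]; linarith
        filter_upwards [Metric.isOpen_ball.mem_nhds hy] with z hz using hzero z hz
      · rw [Metric.mem_closedBall] at hz
        rw [Metric.mem_ball]
        have := dist_triangle z x₁ y
        rw [dist_comm x₁ y] at this
        linarith
  exact fun x hx => (hsub hx).self_of_nhds

lemma IsSolution.isSuperharmonic {G : Set (EuclideanSpace ℝ (Fin N))} (hh : IsSolution Ω μ G h) :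
    IsSuperharmonic Ω μ G h := by
  obtain ⟨hc, Dh, hH1, hw⟩ := hh
  exact ⟨hc, Dh, hH1, fun φ Dφ hφ _ => (hw φ Dφ hφ).ge⟩

lemma IsPositiveLocalSuperharmonic.le_quarter (hN : 0 < N) (hΩ : IsBoundedC2Domain Ω)
    (hh : IsPositiveLocalSuperharmonic Ω μ h) : μ ≤ 1 / 4 := by
  by_contra! hμ
  obtain ⟨ρ, hρ, hsup, hpos⟩ := hh
  obtain ⟨O, hOs, -, ⟨x, hx⟩, hz⟩ := hsup.exists_open_eq_zero hN hΩ hμ hρ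
    (strip_isOpen hΩ.isOpen ρ) (fun x hx => hx.1) subset_rfl fun x hx => (hpos x hx).le
  exact (hpos x (hOs hx)).ne' (hz x hx)

/-- Nonexistence of nontrivial nonnegative solutions for `μ > 1/4`. -/
lemma IsSolution.eq_zero (hN : 0 < N) (hΩ : IsBoundedC2Domain Ω) (hμ : 1 / 4 < μ)
    (hh : IsSolution Ω μ Ω h) (h0 : ∀ x ∈ Ω, 0 ≤ h x) : ∀ x ∈ Ω, h x = 0 := by
  obtain ⟨O, hOs, hO, ⟨x, hx⟩, hz⟩ := hh.isSuperharmonic.exists_open_eq_zero hN hΩ hμ one_pos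
    hΩ.isOpen subset_rfl (fun x hx => hx.1) h0
  exact hh.isSuperharmonic.eq_zero_of_open hΩ.isOpen hΩ.isConnected.isPreconnected
    (fun x hx => bdist_pos hΩ.isOpen (hΩ.frontier_nonempty hN) hx) (by linarith) h0 hO
    ⟨x, (hOs hx).1, hx⟩ hz

end Propagation

/-! ### The uniform exterior ball and semiconcavity of the distance -/

section ExteriorBall

variable {N : ℕ} {Ω : Set (EuclideanSpace ℝ (Fin N))}

/-- A vector in the polar of the half-space `{⟪ν, w⟫ < 0}` is a nonnegative multiple of `ν`. -/
lemma eq_norm_smul_of_forall_inner_nonpos {a ν : EuclideanSpace ℝ (Fin N)} (hν : ‖ν‖ = 1)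
    (h : ∀ w, inner ℝ ν w < 0 → inner ℝ a w ≤ 0) : a = ‖a‖ • ν := by
  have hνν : inner ℝ ν ν = 1 := by rw [real_inner_self_eq_norm_sq, hν, one_pow]
  set t := inner ℝ a ν with ht
  have ht' : inner ℝ ν a = t := real_inner_comm _ _
  have ht0 : 0 ≤ t := by
    have := h (-ν) (by rw [inner_neg_right, hνν]; norm_num)
    rw [inner_neg_right] at this
    linarith
  have h1 : ∀ η > 0, ‖a‖ ^ 2 ≤ t ^ 2 + η * t := fun η hη => by
    have := h (a - (t + η) • ν) (by
      rw [inner_sub_right, real_inner_smul_right, hνν, ht']; linarith)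
    rw [inner_sub_right, real_inner_smul_right, real_inner_self_eq_norm_sq, ← ht] at this
    linarith
  have h2 : ‖a‖ ^ 2 ≤ t ^ 2 := by
    refine le_of_forall_pos_le_add fun ε hε => ?_
    refine (h1 (ε / (t + 1)) (by positivity)).trans ?_
    gcongr
    rw [div_mul_eq_mul_div, div_le_iff₀ (by positivity)]
    nlinarith
  have h3 : ‖a‖ ≤ t := (sq_le_sq₀ (norm_nonneg a) ht0).1 h2
  have h4 : ‖a - ‖a‖ • ν‖ ^ 2 ≤ 0 := by
    rw [norm_sub_sq_real, real_inner_smul_right, norm_smul, norm_norm, hν, ← ht]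
    nlinarith [norm_nonneg a]
  have h5 : ‖a - ‖a‖ • ν‖ = 0 := by
    have := sq_nonneg ‖a - ‖a‖ • ν‖
    exact pow_eq_zero_iff (two_ne_zero) |>.1 (le_antisymm h4 this)
  exact sub_eq_zero.1 (norm_eq_zero.1 h5)

lemma ball_bdist_subset (hΩ : IsOpen Ω) {x : EuclideanSpace ℝ (Fin N)} (hx : x ∈ Ω) :
    Metric.ball x (bdist Ω x) ⊆ Ω := fun y hy => by
  by_contra h
  have := bdist_le_dist_of_notMem hΩ hx h
  rw [Metric.mem_ball, dist_comm] at hy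
  linarith

/-- At a boundary point `y` nearest to a point `x` of `Ω`, the gradient of a defining function
points in the direction `y - x`, because `Ω` contains the ball about `x` that touches `y`. -/
lemma gradient_defining_eq (hΩ : IsOpen Ω) {U : Set (EuclideanSpace ℝ (Fin N))} (hU : IsOpen U)
    {f : EuclideanSpace ℝ (Fin N) → ℝ} (hfU : Ω ∩ U = {x | x ∈ U ∧ f x < 0})
    {x y : EuclideanSpace ℝ (Fin N)} (hx : x ∈ Ω) (hyU : y ∈ U) (hfy : f y = 0)
    (hf : DifferentiableAt ℝ f y) (hxy : dist x y = bdist Ω x) {ν : EuclideanSpace ℝ (Fin N)}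
    (hν : ‖ν‖ = 1) (hyx : y - x = dist x y • ν) (hpos : 0 < dist x y) :
    gradient f y = ‖gradient f y‖ • ν := by
  refine eq_norm_smul_of_forall_inner_nonpos hν fun w hw => ?_
  rw [inner_gradient_left]
  have hd : HasDerivAt (fun s : ℝ => f (y + s • w)) (fderiv ℝ f y w) 0 := by
    have h1 : HasDerivAt (fun s : ℝ => y + s • w) w 0 := by
      simpa using ((hasDerivAt_id (0 : ℝ)).smul_const w).const_add y
    have h2 : HasFDerivAt f (fderiv ℝ f y) (y + (0 : ℝ) • w) := by simpa using hf.hasFDerivAt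
    exact h2.comp_hasDerivAt (0 : ℝ) h1
  by_contra! hlt
  -- otherwise `f` is positive at points of the touching ball
  have hslope := hasDerivAt_iff_tendsto_slope_zero.1 hd
  have ev1 := (hslope.mono_left (nhdsWithin_mono 0 (fun s (hs : s ∈ Ioi (0 : ℝ)) =>
    ne_of_gt hs))).eventually (lt_mem_nhds hlt)
  have hcont : Filter.Tendsto (fun s : ℝ => y + s • w) (nhdsWithin 0 (Ioi 0)) (nhds y) := by
    have : Continuous fun s : ℝ => y + s • w := by fun_prop
    simpa using (this.tendsto 0).mono_left nhdsWithin_le_nhds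
  have ev2 := hcont.eventually (hU.mem_nhds hyU)
  have ev3 : ∀ᶠ s in nhdsWithin (0 : ℝ) (Ioi 0), s * ‖w‖ ^ 2 < -(2 * dist x y * inner ℝ ν w) := by
    have : Continuous fun s : ℝ => s * ‖w‖ ^ 2 := by fun_prop
    have h3 := (this.tendsto 0).mono_left (nhdsWithin_le_nhds (s := Ioi 0))
    refine h3.eventually (gt_mem_nhds ?_)
    rw [zero_mul]
    nlinarith [mul_pos hpos (neg_pos.2 hw)]
  obtain ⟨s, ⟨⟨hs1, hs2⟩, hs3⟩, hs0⟩ :=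
    ((ev1.and ev2).and ev3 |>.and self_mem_nhdsWithin).exists
  simp only [zero_add, zero_smul, add_zero, hfy, sub_zero, smul_eq_mul] at hs1 hs0
  have hball : y + s • w ∈ Metric.ball x (bdist Ω x) := by
    rw [Metric.mem_ball, dist_eq_norm, ← hxy]
    have e : y + s • w - x = dist x y • ν + s • w := by rw [← hyx]; abel
    rw [e]
    refine lt_of_pow_lt_pow_left₀ 2 hpos.le ?_
    rw [norm_add_sq_real, norm_smul, norm_smul, hν, real_inner_smul_left, real_inner_smul_right,
      mul_one, Real.norm_eq_abs, Real.norm_eq_abs, mul_pow, sq_abs, sq_abs]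
    nlinarith
  have : y + s • w ∈ {x | x ∈ U ∧ f x < 0} := hfU ▸ ⟨ball_bdist_subset hΩ hx hball, hs2⟩
  have h4 : 0 < f (y + s • w) := by
    by_contra! hn
    exact absurd hs1 (not_lt.2 (mul_nonpos_of_nonneg_of_nonpos (inv_pos.2 hs0).le hn))
  exact absurd this.2 (not_lt.2 h4.le)

/-- Boundary points near `p` have exterior balls of a common radius. -/
lemma exists_exterior_ball_near (hΩ : IsBoundedC2Domain Ω) {p : EuclideanSpace ℝ (Fin N)}
    (hp : p ∈ frontier Ω) : ∃ r > 0, ∃ R₀ > 0, ∀ y ∈ frontier Ω, y ∈ Metric.ball p r →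
      ∀ R, 0 < R → R ≤ R₀ → ∀ x ∈ Ω, dist x y = bdist Ω x → ∀ ν : EuclideanSpace ℝ (Fin N),
        ‖ν‖ = 1 → 0 < dist x y → y - x = dist x y • ν →
          ∀ z ∈ Ω, R ≤ ‖z - (y + R • ν)‖ := by
  obtain ⟨U, hU, hpU, f, hf, hdf, hfU⟩ := hΩ.boundary p hp
  have hdf1 : ContDiffAt ℝ 1 (fderiv ℝ f) p :=
    (hf.contDiffAt (hU.mem_nhds hpU)).fderiv_right (by norm_num)
  obtain ⟨K, t, ht, hKt⟩ := hdf1.exists_lipschitzOnWith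
  have hmp : 0 < ‖fderiv ℝ f p‖ := norm_pos_iff.2 (hdf p hpU)
  have hev : ∀ᶠ y in nhds p, ‖fderiv ℝ f p‖ / 2 < ‖fderiv ℝ f y‖ :=
    hdf1.continuousAt.norm.eventually (lt_mem_nhds (by linarith))
  obtain ⟨r, hr, hball⟩ := Metric.mem_nhds_iff.1
    (Filter.inter_mem (Filter.inter_mem ht (hU.mem_nhds hpU)) hev)
  set m := ‖fderiv ℝ f p‖ / 2 with hm
  have hm0 : 0 < m := by positivity
  refine ⟨r / 2, by positivity, min (r / 4) (m / (2 * (K + 1))), by positivity, ?_⟩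
  intro y hy hyp R hR hR₀ x hx hxy ν hν hpos hyx z hz
  by_contra! hlt
  have hyb : y ∈ Metric.ball p r := Metric.ball_subset_ball (by linarith) hyp
  have hyU : y ∈ U := (hball hyb).1.2
  have hfy := defining_eq_zero hΩ.isOpen hU hf.continuousOn hfU hyU hy
  have hfd : ∀ w ∈ U, DifferentiableAt ℝ f w := fun w hw =>
    (hf.differentiableOn (by simp)).differentiableAt (hU.mem_nhds hw)
  have hgrad := gradient_defining_eq hΩ.isOpen hU hfU hx hyU hfy (hfd y hyU) hxy hν hyx hpos
  set v := z - y with hv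
  have hsq : ‖v‖ ^ 2 < 2 * R * inner ℝ ν v := by
    have e : z - (y + R • ν) = v - R • ν := by rw [hv]; abel
    rw [e] at hlt
    have := pow_lt_pow_left₀ hlt (norm_nonneg _) two_ne_zero
    rw [norm_sub_sq_real, norm_smul, hν, real_inner_smul_right, mul_one, Real.norm_eq_abs, sq_abs,
      real_inner_comm] at this
    linarith
  have hin : inner ℝ ν v ≤ ‖v‖ := by
    have := real_inner_le_norm ν v
    rwa [hν, one_mul] at this
  have hin0 : 0 < inner ℝ ν v := by
    by_contra! h'
    nlinarith [sq_nonneg ‖v‖]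
  have hv2R : ‖v‖ < 2 * R := by
    by_contra! h'
    nlinarith
  have hvr : ‖v‖ < r / 2 := by linarith [min_le_left (r / 4) (m / (2 * ((K : ℝ) + 1)))]
  have hsub : Metric.closedBall y ‖v‖ ⊆ Metric.ball p r := fun w hw => by
    rw [Metric.mem_closedBall] at hw
    rw [Metric.mem_ball] at hyp ⊢
    linarith [dist_triangle w y p]
  have hzb : z ∈ Metric.closedBall y ‖v‖ := by rw [Metric.mem_closedBall, dist_eq_norm]
  have hmv := (convex_closedBall y ‖v‖).norm_image_sub_le_of_norm_fderiv_le' (𝕜 := ℝ) (f := f)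
    (φ := fderiv ℝ f y) (C := K * ‖v‖) (fun w hw => hfd w (hball (hsub hw)).1.2) (fun w hw => by
      refine (hKt.norm_sub_le (hball (hsub hw)).1.1 (hball hyb).1.1).trans ?_
      rw [Metric.mem_closedBall, dist_eq_norm] at hw
      gcongr) (Metric.mem_closedBall_self (norm_nonneg v)) hzb
  rw [← hv, hfy, sub_zero, Real.norm_eq_abs] at hmv
  have hlow := (abs_le.1 hmv).1
  have hder : fderiv ℝ f y v = ‖gradient f y‖ * inner ℝ ν v := by
    rw [← inner_gradient_left, hgrad, real_inner_smul_left, norm_smul, norm_norm, hν, mul_one]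
  have hgm : m ≤ ‖gradient f y‖ := by
    have : ‖gradient f y‖ = ‖fderiv ℝ f y‖ := LinearIsometryEquiv.norm_map _ _
    rw [this]
    exact (hball hyb).2.le
  have hRm : R * (2 * (K + 1)) ≤ m := by
    rw [← le_div_iff₀ (by positivity)]
    exact hR₀.trans (min_le_right _ _)
  have hfz : 0 ≤ f z := by
    have h1 : m * inner ℝ ν v ≤ ‖gradient f y‖ * inner ℝ ν v := by gcongr
    have h2 : (K : ℝ) * ‖v‖ ^ 2 ≤ K * (2 * R * inner ℝ ν v) := by gcongr
    have h3 : R * (2 * (K + 1)) * inner ℝ ν v ≤ m * inner ℝ ν v := by gcongr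
    nlinarith [mul_pos hR hin0]
  have : z ∈ {x | x ∈ U ∧ f x < 0} := hfU ▸ ⟨hz, (hball (hsub hzb)).1.2⟩
  exact absurd this.2 (not_lt.2 hfz)

/-- All nearest boundary points have exterior balls of a common radius. -/
lemma exists_uniform_exterior_ball (hΩ : IsBoundedC2Domain Ω) :
    ∃ R₀ > 0, ∀ y ∈ frontier Ω, ∀ R, 0 < R → R ≤ R₀ → ∀ x ∈ Ω, dist x y = bdist Ω x →
      ∀ ν : EuclideanSpace ℝ (Fin N), ‖ν‖ = 1 → 0 < dist x y → y - x = dist x y • ν →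
        ∀ z ∈ Ω, R ≤ ‖z - (y + R • ν)‖ := by
  have hcomp : IsCompact (frontier Ω) := Metric.isCompact_of_isClosed_isBounded isClosed_frontier
    (hΩ.isBounded.closure.subset frontier_subset_closure)
  refine hcomp.induction_on (p := fun s => ∃ R₀ > 0, ∀ y ∈ s, ∀ R, 0 < R → R ≤ R₀ → ∀ x ∈ Ω,
    dist x y = bdist Ω x → ∀ ν : EuclideanSpace ℝ (Fin N), ‖ν‖ = 1 → 0 < dist x y →
      y - x = dist x y • ν → ∀ z ∈ Ω, R ≤ ‖z - (y + R • ν)‖) ?_ ?_ ?_ ?_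
  · exact ⟨1, one_pos, fun y hy => absurd hy (notMem_empty y)⟩
  · rintro s t hst ⟨R₀, hR₀, h⟩
    exact ⟨R₀, hR₀, fun y hy => h y (hst hy)⟩
  · rintro s t ⟨R₁, hR₁, h₁⟩ ⟨R₂, hR₂, h₂⟩
    refine ⟨min R₁ R₂, lt_min hR₁ hR₂, fun y hy R hR hRle => ?_⟩
    rcases hy with hy | hy
    · exact h₁ y hy R hR (hRle.trans (min_le_left _ _))
    · exact h₂ y hy R hR (hRle.trans (min_le_right _ _))
  · intro p hp
    obtain ⟨r, hr, R₀, hR₀, h⟩ := exists_exterior_ball_near hΩ hp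
    exact ⟨frontier Ω ∩ Metric.ball p r, inter_mem_nhdsWithin _ (Metric.ball_mem_nhds p hr), R₀,
      hR₀, fun y hy => h y hy.1 hy.2⟩

/-- Semiconcavity of the distance: at each point `x` it is touched from above by the distance to
an exterior ball of radius `R`, whence a one-sided second-order bound with a unit slope `e`. -/
lemma exists_bdist_add_le (hN : 0 < N) (hΩ : IsBoundedC2Domain Ω) :
    ∃ R > 0, ∀ x ∈ Ω, ∃ e : EuclideanSpace ℝ (Fin N), ‖e‖ = 1 ∧ ∀ v, x + v ∈ Ω →
      bdist Ω (x + v) ≤ bdist Ω x + inner ℝ e v + ‖v‖ ^ 2 / (2 * R) := by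
  obtain ⟨R, hR, hext⟩ := exists_uniform_exterior_ball hΩ
  have hne := hΩ.frontier_nonempty hN
  have hcomp : IsCompact (frontier Ω) := Metric.isCompact_of_isClosed_isBounded isClosed_frontier
    (hΩ.isBounded.closure.subset frontier_subset_closure)
  refine ⟨R, hR, fun x hx => ?_⟩
  obtain ⟨y, hy, hxy⟩ := hcomp.exists_infDist_eq_dist hne x
  have hδ : 0 < dist x y := hxy ▸ bdist_pos hΩ.isOpen hne hx
  set δ := dist x y with hδd
  set ν := δ⁻¹ • (y - x) with hν
  have hyx : y - x = δ • ν := by rw [hν, smul_smul, mul_inv_cancel₀ hδ.ne', one_smul]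
  have hν1 : ‖ν‖ = 1 := by
    rw [hν, norm_smul, norm_inv, Real.norm_eq_abs, abs_of_pos hδ, ← dist_eq_norm, dist_comm,
      ← hδd, inv_mul_cancel₀ hδ.ne']
  refine ⟨-ν, by rw [norm_neg, hν1], fun v hv => ?_⟩
  set z := y + R • ν with hz
  have hout : ∀ R', 0 < R' → R' < R → bdist Ω (x + v) ≤ ‖x + v - z‖ - R' := fun R' hR' hlt => by
    have hRle : R ≤ ‖x + v - z‖ := hext y hy R hR le_rfl x hx hxy.symm ν hν1 hδ hyx (x + v) hv
    set ℓ := ‖x + v - z‖ with hℓ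
    have hℓ0 : 0 < ℓ := hR.trans_le hRle
    set z' := z + (R' / ℓ) • (x + v - z) with hz'
    have hz'Ω : z' ∉ Ω := fun hmem => by
      have := hext y hy R hR le_rfl x hx hxy.symm ν hν1 hδ hyx z' hmem
      rw [← hz, hz', add_sub_cancel_left, norm_smul, ← hℓ, Real.norm_eq_abs,
        abs_of_pos (by positivity), div_mul_cancel₀ _ hℓ0.ne'] at this
      linarith
    refine (bdist_le_dist_of_notMem hΩ.isOpen hv hz'Ω).trans (le_of_eq ?_)
    have e : x + v - z' = (1 - R' / ℓ) • (x + v - z) := by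
      rw [hz', sub_smul, one_smul]; abel
    have hle : 0 ≤ 1 - R' / ℓ := by
      rw [sub_nonneg, div_le_one hℓ0]; linarith
    rw [dist_eq_norm, e, norm_smul, ← hℓ, Real.norm_eq_abs, abs_of_nonneg hle]
    field_simp
  have hmain : bdist Ω (x + v) ≤ ‖x + v - z‖ - R := by
    refine le_of_forall_pos_le_add fun ε hε => ?_
    have hmin : 0 < min ε (R / 2) := by positivity
    have h1 := hout (R - min ε (R / 2)) (by linarith [min_le_right ε (R / 2)]) (by linarith)
    linarith [min_le_left ε (R / 2)]
  have hbx : bdist Ω x = δ := hxy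
  rw [hbx, inner_neg_left]
  set d := δ + R with hd
  have hd0 : 0 < d := by positivity
  have e : x + v - z = v - d • ν := by
    have : y = x + δ • ν := by rw [← hyx]; abel
    rw [hz, this, hd, add_smul]; abel
  have hsq : ‖x + v - z‖ ^ 2 = d ^ 2 + 2 * d * (-inner ℝ ν v + ‖v‖ ^ 2 / (2 * d)) := by
    rw [e, norm_sub_sq_real, norm_smul, hν1, real_inner_smul_right, mul_one, Real.norm_eq_abs,
      sq_abs, real_inner_comm]
    field_simp
    ring
  set a := -inner ℝ ν v + ‖v‖ ^ 2 / (2 * d) with ha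
  have hda : 0 ≤ d + a := by
    have := sq_nonneg ‖x + v - z‖
    rw [hsq] at this
    by_contra! h'
    nlinarith
  have hle : ‖x + v - z‖ ≤ d + a := by
    refine (sq_le_sq₀ (norm_nonneg _) hda).1 ?_
    rw [hsq]
    nlinarith [sq_nonneg a]
  have hRd : ‖v‖ ^ 2 / (2 * d) ≤ ‖v‖ ^ 2 / (2 * R) := by
    gcongr
    linarith
  linarith

end ExteriorBall

/-! ### The barrier and its second differences -/

section Barrier

lemma sqrt_one_add_le {u : ℝ} (hu : -1 ≤ u) :
    √(1 + u) ≤ 1 + u / 2 - u ^ 2 / 8 + u ^ 3 / 16 := by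
  have h0 : 0 ≤ 1 + u / 2 - u ^ 2 / 8 + u ^ 3 / 16 := by
    have : 1 + u / 2 - u ^ 2 / 8 + u ^ 3 / 16 =
        5 / 16 + (u + 1) * ((u - 3 / 2) ^ 2 / 16 + 35 / 64) := by ring
    have h1 : 0 ≤ (u + 1) * ((u - 3 / 2) ^ 2 / 16 + 35 / 64) :=
      mul_nonneg (by linarith) (by positivity)
    linarith
  rw [Real.sqrt_le_left h0]
  have : (1 + u / 2 - u ^ 2 / 8 + u ^ 3 / 16) ^ 2 =
      1 + u + u ^ 4 * ((u / 16 - 1 / 8) ^ 2 + 1 / 16) := by ring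
  rw [this]
  have : 0 ≤ u ^ 4 * ((u / 16 - 1 / 8) ^ 2 + 1 / 16) := by positivity
  linarith

lemma sqrt_add_le {t τ : ℝ} (ht : 0 < t) (hτ : 0 ≤ t + τ) :
    √(t + τ) ≤ √t + τ / (2 * √t) - τ ^ 2 / (8 * t * √t) + τ ^ 3 / (16 * t ^ 2 * √t) := by
  have hu : -1 ≤ τ / t := by rw [le_div_iff₀ ht]; linarith
  have h := sqrt_one_add_le hu
  have e : t + τ = t * (1 + τ / t) := by field_simp
  have hs : 0 < √t := Real.sqrt_pos.2 ht
  rw [e, Real.sqrt_mul ht.le]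
  refine (mul_le_mul_of_nonneg_left h hs.le).trans (le_of_eq ?_)
  have hs2 : √t ^ 2 = t := Real.sq_sqrt ht.le
  set σ := √t
  rw [← hs2]
  field_simp

/-- The barrier profile `√t - t`; the correction `-t` makes it a strict supersolution of the
critical Hardy equation for small `t`. -/
noncomputable def barrierProfile (t : ℝ) : ℝ := √t - t

lemma barrierProfile_mono {s t : ℝ} (hs : 0 ≤ s) (hst : s ≤ t) (ht : t ≤ 1 / 4) :
    barrierProfile s ≤ barrierProfile t := by
  have h1 : √s ≤ √t := Real.sqrt_le_sqrt hst
  have h2 : √t ≤ 1 / 2 := Real.sqrt_le_iff.2 ⟨by norm_num, by linarith⟩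
  have hs2 : √s ^ 2 = s := Real.sq_sqrt hs
  have ht2 : √t ^ 2 = t := Real.sq_sqrt (hs.trans hst)
  unfold barrierProfile
  nlinarith [Real.sqrt_nonneg s]

lemma barrierProfile_pos {t : ℝ} (h0 : 0 < t) (h1 : t < 1) : 0 < barrierProfile t := by
  have hs : 0 < √t := Real.sqrt_pos.2 h0
  have hs2 : √t ^ 2 = t := Real.sq_sqrt h0.le
  have h2 : √t < 1 := by rw [Real.sqrt_lt' one_pos]; simpa using h1
  unfold barrierProfile
  nlinarith

/-- Second difference of the barrier profile along increments `±sc + s²/(2R)`, the bounds that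
semiconcavity gives for the distance. -/
lemma barrierProfile_second_difference {R t s c : ℝ} (hR : 0 < R) (ht : 0 < t) (hs0 : 0 < s)
    (hs1 : s ≤ 1) (hc : c ^ 2 ≤ 1) (hp : 0 ≤ t + (s * c + s ^ 2 / (2 * R)))
    (hm : 0 ≤ t + (-(s * c) + s ^ 2 / (2 * R))) :
    barrierProfile (t + (s * c + s ^ 2 / (2 * R))) +
      barrierProfile (t + (-(s * c) + s ^ 2 / (2 * R))) - 2 * barrierProfile t ≤
      s ^ 2 * (1 / (2 * R * √t) - c ^ 2 / (4 * t * √t)) +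
        s ^ 4 * ((1 / (4 * R ^ 3) + 3 / R) / (16 * t ^ 2 * √t)) := by
  have h1 := sqrt_add_le ht hp
  have h2 := sqrt_add_le ht hm
  have hσ : 0 < √t := Real.sqrt_pos.2 ht
  unfold barrierProfile
  set β := s ^ 2 / (2 * R) with hβ
  have hβ0 : 0 < β := by positivity
  set σ := √t
  have e1 : (s * c + β) / (2 * σ) + (-(s * c) + β) / (2 * σ) = s ^ 2 * (1 / (2 * R * σ)) := by
    rw [hβ]; field_simp; ring
  have e2 : s ^ 2 * (c ^ 2 / (4 * t * σ)) ≤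
      (s * c + β) ^ 2 / (8 * t * σ) + (-(s * c) + β) ^ 2 / (8 * t * σ) := by
    have : (s * c + β) ^ 2 / (8 * t * σ) + (-(s * c) + β) ^ 2 / (8 * t * σ) =
        s ^ 2 * (c ^ 2 / (4 * t * σ)) + β ^ 2 / (4 * t * σ) := by field_simp; ring
    rw [this]
    have : 0 ≤ β ^ 2 / (4 * t * σ) := by positivity
    linarith
  have e3 : (s * c + β) ^ 3 / (16 * t ^ 2 * σ) + (-(s * c) + β) ^ 3 / (16 * t ^ 2 * σ) ≤
      s ^ 4 * ((1 / (4 * R ^ 3) + 3 / R) / (16 * t ^ 2 * σ)) := by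
    rw [← add_div, ← mul_div_assoc]
    gcongr
    have : (s * c + β) ^ 3 + (-(s * c) + β) ^ 3 =
        s ^ 4 * (s ^ 2 * (1 / (4 * R ^ 3)) + 3 / R * c ^ 2) := by
      rw [hβ]; field_simp; ring
    rw [this]
    have hs2 : s ^ 2 ≤ 1 := pow_le_one₀ hs0.le hs1
    have a1 : s ^ 2 * (1 / (4 * R ^ 3)) ≤ 1 * (1 / (4 * R ^ 3)) := by gcongr
    have a2 : 3 / R * c ^ 2 ≤ 3 / R * 1 := by gcongr
    refine mul_le_mul_of_nonneg_left ?_ (by positivity)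
    linarith
  have e4 : 0 < β := hβ0
  linarith

variable {N : ℕ} {Ω : Set (EuclideanSpace ℝ (Fin N))}

/-- The radius of the strip in which the barrier is a supersolution is determined by the
semiconcavity constant; the second differences of the barrier are controlled locally uniformly. -/
lemma exists_barrier_second_difference (hN : 0 < N) (hΩ : IsBoundedC2Domain Ω)
    (b : OrthonormalBasis (Fin N) ℝ (EuclideanSpace ℝ (Fin N))) :
    ∃ ρ > 0, ρ ≤ 1 / 8 ∧ ∀ a > 0, ∃ C : ℝ, ∃ s₀ > 0, ∀ x ∈ strip Ω ρ, a ≤ bdist Ω x →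
      ∀ s > 0, s < s₀ →
        ∑ i, (barrierProfile (bdist Ω (x + s • b i)) + barrierProfile (bdist Ω (x - s • b i)) -
          2 * barrierProfile (bdist Ω x)) ≤
          -(s ^ 2 * (barrierProfile (bdist Ω x) / (4 * bdist Ω x ^ 2))) + C * s ^ 4 := by
  obtain ⟨R, hR, hsemi⟩ := exists_bdist_add_le hN hΩ
  have hN' : (0 : ℝ) < N := by exact_mod_cast hN
  refine ⟨min (1 / 8) ((R / (2 * N)) ^ 2), by positivity, min_le_left _ _, fun a ha => ?_⟩
  refine ⟨N * ((1 / (4 * R ^ 3) + 3 / R) / (16 * a ^ 2 * √a)), min (min 1 a) (min (1 / 16)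
    (R / 8)), by positivity, fun x hx hax s hs0 hs => ?_⟩
  have hs1 : s < 1 := hs.trans_le ((min_le_left _ _).trans (min_le_left _ _))
  have hsa : s < a := hs.trans_le ((min_le_left _ _).trans (min_le_right _ _))
  have hs16 : s < 1 / 16 := hs.trans_le ((min_le_right _ _).trans (min_le_left _ _))
  have hsR : s < R / 8 := hs.trans_le ((min_le_right _ _).trans (min_le_right _ _))
  obtain ⟨e, he, hexp⟩ := hsemi x hx.1
  have ht8 : bdist Ω x < 1 / 8 := hx.2.trans_le (min_le_left _ _)
  have htR : bdist Ω x < (R / (2 * N)) ^ 2 := hx.2.trans_le (min_le_right _ _)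
  set t := bdist Ω x with ht
  have ht0 : 0 < t := ha.trans_le hax
  have hin : ∀ v : EuclideanSpace ℝ (Fin N), ‖v‖ = s → x + v ∈ Ω := fun v hv => by
    refine ball_bdist_subset hΩ.isOpen hx.1 ?_
    rw [Metric.mem_ball, dist_eq_norm, add_sub_cancel_left, hv]
    linarith
  have hβ : s ^ 2 / (2 * R) ≤ 1 / 16 := by
    rw [div_le_iff₀ (by positivity)]
    nlinarith
  have hstep : ∀ v : EuclideanSpace ℝ (Fin N), ‖v‖ = s →
      0 ≤ t + (inner ℝ e v + s ^ 2 / (2 * R)) ∧ barrierProfile (bdist Ω (x + v)) ≤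
        barrierProfile (t + (inner ℝ e v + s ^ 2 / (2 * R))) := fun v hv => by
    have h1 := hexp v (hin v hv)
    rw [hv] at h1
    have h0 : 0 ≤ bdist Ω (x + v) := Metric.infDist_nonneg
    have h2 : inner ℝ e v ≤ s := by
      have := real_inner_le_norm e v
      rwa [he, hv, one_mul] at this
    exact ⟨by linarith, barrierProfile_mono h0 (by linarith) (by linarith)⟩
  have hterm : ∀ i, barrierProfile (bdist Ω (x + s • b i)) +
      barrierProfile (bdist Ω (x - s • b i)) - 2 * barrierProfile t ≤
      s ^ 2 * (1 / (2 * R * √t) - inner ℝ e (b i) ^ 2 / (4 * t * √t)) +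
        s ^ 4 * ((1 / (4 * R ^ 3) + 3 / R) / (16 * a ^ 2 * √a)) := fun i => by
    have hn : ‖s • b i‖ = s := by
      rw [norm_smul, b.norm_eq_one, mul_one, Real.norm_eq_abs, abs_of_pos hs0]
    obtain ⟨p0, p1⟩ := hstep (s • b i) hn
    obtain ⟨m0, m1⟩ := hstep (-(s • b i)) (by rw [norm_neg, hn])
    rw [inner_neg_right] at m0 m1
    rw [← sub_eq_add_neg] at m1
    rw [real_inner_smul_right] at p0 p1 m0 m1
    have hc : inner ℝ e (b i) ^ 2 ≤ 1 := by
      have := abs_real_inner_le_norm e (b i)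
      rw [he, b.norm_eq_one, one_mul] at this
      rw [← sq_abs]
      exact pow_le_one₀ (abs_nonneg _) this
    have h3 := barrierProfile_second_difference hR ht0 hs0 hs1.le hc p0 m0
    have h4 : s ^ 4 * ((1 / (4 * R ^ 3) + 3 / R) / (16 * t ^ 2 * √t)) ≤
        s ^ 4 * ((1 / (4 * R ^ 3) + 3 / R) / (16 * a ^ 2 * √a)) := by
      have : 0 < √a := Real.sqrt_pos.2 ha
      gcongr
    linarith
  refine (Finset.sum_le_sum fun i _ => hterm i).trans ?_
  have hsum : ∑ i, inner ℝ e (b i) ^ 2 = 1 := by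
    rw [b.sum_sq_inner_left e, he, one_pow]
  have hsum' : ∑ i, inner ℝ e (b i) ^ 2 / (4 * t * √t) = 1 / (4 * t * √t) := by
    rw [← Finset.sum_div, hsum]
  rw [Finset.sum_add_distrib, ← Finset.mul_sum, Finset.sum_sub_distrib, hsum']
  simp only [Finset.sum_const, Finset.card_univ, Fintype.card_fin, nsmul_eq_mul]
  have hσ : 0 < √t := Real.sqrt_pos.2 ht0
  have hσR : √t ≤ R / (2 * N) := (Real.sqrt_le_left (by positivity)).2 htR.le
  have hmain : N * (1 / (2 * R * √t)) - 1 / (4 * t * √t) ≤ -(barrierProfile t / (4 * t ^ 2)) := by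
    unfold barrierProfile
    have hs2 : √t ^ 2 = t := Real.sq_sqrt ht0.le
    set σ := √t
    rw [← hs2]
    have e1 : -((σ - σ ^ 2) / (4 * (σ ^ 2) ^ 2)) - (N * (1 / (2 * R * σ)) - 1 / (4 * σ ^ 2 * σ)) =
        (R - 2 * N * σ) / (4 * R * σ ^ 2) := by field_simp; ring
    have e2 : 0 ≤ (R - 2 * N * σ) / (4 * R * σ ^ 2) := by
      refine div_nonneg ?_ (by positivity)
      rw [le_div_iff₀ (by positivity)] at hσR
      linarith
    linarith
  have := mul_le_mul_of_nonneg_left hmain (sq_nonneg s)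
  linarith

end Barrier

/-! ### From second differences to the Laplacian of mollifications -/

section SecondDifference

lemma deriv_deriv_le_of_second_difference {g : ℝ → ℝ} (hg : ContDiff ℝ 2 g) {w C s₀ : ℝ}
    (hs₀ : 0 < s₀)
    (h : ∀ s > 0, s < s₀ → g s + g (-s) - 2 * g 0 ≤ -(s ^ 2 * w) + C * s ^ 4) :
    deriv (deriv g) 0 ≤ -w := by
  by_contra! hlt
  have hg1 : ∀ s, HasDerivAt g (deriv g s) s := fun s =>
    (hg.differentiable (by simp)).differentiableAt.hasDerivAt
  have hg' : ContDiff ℝ 1 (deriv g) := (contDiff_succ_iff_deriv.1 hg).2.2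
  have hg2 : ∀ s, HasDerivAt (deriv g) (deriv (deriv g) s) s := fun s =>
    (hg'.differentiable (by simp)).differentiableAt.hasDerivAt
  -- `v` lies strictly between `-g''(0)` and `w`
  set v := (w - deriv (deriv g) 0) / 2 with hv
  have hvw : v < w := by rw [hv]; linarith
  have hvg : 0 < deriv (deriv g) 0 + v := by rw [hv]; linarith
  set P : ℝ → ℝ := fun s => g s + g (-s) - 2 * g 0 + v * s ^ 2 with hP
  have hP1 : ∀ s, HasDerivAt P (deriv g s - deriv g (-s) + 2 * v * s) s := fun s => by
    have h1 := (((hg1 s).add ((hg1 (-s)).comp s (hasDerivAt_neg s))).sub_const (2 * g 0)).add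
      ((hasDerivAt_pow 2 s).const_mul v)
    refine h1.congr_deriv ?_
    push_cast
    ring
  have hP1' : deriv P = fun s => deriv g s - deriv g (-s) + 2 * v * s :=
    funext fun s => (hP1 s).deriv
  have hP2 : HasDerivAt (deriv P) (2 * (deriv (deriv g) 0 + v)) 0 := by
    rw [hP1']
    have hg20 : HasDerivAt (deriv g) (deriv (deriv g) 0) (-0) := by rw [neg_zero]; exact hg2 0
    have h1 := ((hg2 0).sub (hg20.comp 0 (hasDerivAt_neg 0))).add
      ((hasDerivAt_id (0 : ℝ)).const_mul (2 * v))
    refine h1.congr_deriv ?_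
    ring
  have hmin : IsLocalMin P 0 := by
    refine isLocalMin_of_deriv_deriv_pos ?_ ?_ (hP1 0).continuousAt
    · rw [hP2.deriv]; linarith
    · rw [hP1']; simp
  have hP0 : P 0 = 0 := by simp [hP]; ring
  have ev1 : ∀ᶠ s in nhdsWithin (0 : ℝ) (Ioi 0), 0 ≤ P s := by
    filter_upwards [nhdsWithin_le_nhds hmin] with s hs
    exact hP0 ▸ hs
  have ev2 : ∀ᶠ s in nhdsWithin (0 : ℝ) (Ioi 0), C * s ^ 2 < w - v := by
    have : Continuous fun s : ℝ => C * s ^ 2 := by fun_prop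
    have h3 := (this.tendsto 0).mono_left (nhdsWithin_le_nhds (s := Ioi 0))
    refine h3.eventually (gt_mem_nhds ?_)
    simpa using hvw
  have ev3 : ∀ᶠ s in nhdsWithin (0 : ℝ) (Ioi 0), s < s₀ :=
    nhdsWithin_le_nhds (gt_mem_nhds hs₀)
  obtain ⟨s, ⟨⟨h1, h2⟩, h3⟩, hs⟩ := ((ev1.and ev2).and ev3 |>.and self_mem_nhdsWithin).exists
  have hs : 0 < s := hs
  have h4 := h s hs h3
  have h5 : s ^ 2 * (C * s ^ 2) < s ^ 2 * (w - v) := by gcongr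
  simp only [hP] at h1
  nlinarith

variable {N : ℕ}

lemma laplacian_le_of_second_difference
    (b : OrthonormalBasis (Fin N) ℝ (EuclideanSpace ℝ (Fin N)))
    {f : EuclideanSpace ℝ (Fin N) → ℝ} (hf : ContDiff ℝ 2 f) {x : EuclideanSpace ℝ (Fin N)}
    {w C s₀ : ℝ} (hs₀ : 0 < s₀)
    (h : ∀ s > 0, s < s₀ →
      ∑ i, (f (x + s • b i) + f (x - s • b i) - 2 * f x) ≤ -(s ^ 2 * w) + C * s ^ 4) :
    (Δ f) x ≤ -w := by
  have hl : ∀ i, ContDiff ℝ 2 fun s : ℝ => f (x + s • b i) := fun i =>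
    hf.comp (contDiff_const.add (contDiff_id.smul contDiff_const))
  have hd : ∀ i, Differentiable ℝ fun s : ℝ => f (x + s • b i) := fun i =>
    (hl i).differentiable (by simp)
  have hd' : ∀ i, Differentiable ℝ (deriv fun s : ℝ => f (x + s • b i)) := fun i =>
    ((contDiff_succ_iff_deriv.1 (hl i)).2.2 : ContDiff ℝ 1 _).differentiable (by simp)
  have hsum : deriv (deriv fun s : ℝ => ∑ i, f (x + s • b i)) 0 = (Δ f) x := by
    have h1 : (deriv fun s : ℝ => ∑ i, f (x + s • b i)) = fun s =>
        ∑ i, deriv (fun s : ℝ => f (x + s • b i)) s := by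
      funext s
      exact deriv_fun_sum fun i _ => (hd i).differentiableAt
    rw [h1, deriv_fun_sum fun i _ => (hd' i).differentiableAt, laplacian_eq_sum_deriv b hf]
  rw [← hsum]
  refine deriv_deriv_le_of_second_difference (C := C) (ContDiff.sum fun i _ => hl i) hs₀
    fun s hs hss => le_trans (le_of_eq ?_) (h s hs hss)
  rw [Finset.sum_sub_distrib, Finset.sum_add_distrib, ← Finset.mul_sum]
  simp only [neg_smul, zero_smul, add_zero, sub_eq_add_neg]

end SecondDifference

section Mollification

open scoped Convolution NNReal
open ContinuousLinearMap

variable {N : ℕ} {H W : EuclideanSpace ℝ (Fin N) → ℝ} {L : ℝ≥0}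
  (η : ContDiffBump (0 : EuclideanSpace ℝ (Fin N)))

lemma mollify_contDiff (hH : Continuous H) :
    ContDiff ℝ ∞ (η.normed volume ⋆[lsmul ℝ ℝ, volume] H) :=
  η.hasCompactSupport_normed.contDiff_convolution_left _ η.contDiff_normed
    hH.locallyIntegrable

lemma mollify_integrand_integrable {F : Type*} [NormedAddCommGroup F] [NormedSpace ℝ F]
    {f : EuclideanSpace ℝ (Fin N) → F} (hf : Continuous f) (x : EuclideanSpace ℝ (Fin N)) :
    Integrable (fun y => η.normed volume y • f (x - y)) volume :=
  (η.continuous_normed.smul (hf.comp (by fun_prop))).integrable_of_hasCompactSupport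
    η.hasCompactSupport_normed.smul_right

lemma norm_mollify_le {F : Type*} [NormedAddCommGroup F] [NormedSpace ℝ F]
    {f : EuclideanSpace ℝ (Fin N) → F} {B : ℝ} (hB : ∀ x, ‖f x‖ ≤ B)
    (x : EuclideanSpace ℝ (Fin N)) :
    ‖(η.normed volume ⋆[lsmul ℝ ℝ, volume] f) x‖ ≤ B := by
  have h1 : ‖∫ y, η.normed volume y • f (x - y)‖ ≤ ∫ y, η.normed volume y * B := by
    refine norm_integral_le_of_norm_le (η.integrable_normed.mul_const B) (.of_forall fun y => ?_)
    rw [norm_smul, Real.norm_eq_abs, abs_of_nonneg (η.nonneg_normed y)]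
    gcongr
    · exact η.nonneg_normed y
    · exact hB _
  rwa [integral_mul_const, η.integral_normed, one_mul] at h1

/-- The derivative of the mollification of a Lipschitz function is the mollification of its
derivative, which exists almost everywhere by Rademacher's theorem. -/
lemma hasFDerivAt_mollify (hH : LipschitzWith L H) (x : EuclideanSpace ℝ (Fin N)) :
    HasFDerivAt (η.normed volume ⋆[lsmul ℝ ℝ, volume] H)
      ((η.normed volume ⋆[lsmul ℝ ℝ, volume] (fderiv ℝ H)) x) x := by
  refine (hasFDerivAt_integral_of_dominated_loc_of_lip (𝕜 := ℝ) (μ := volume)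
    (F := fun x y => η.normed volume y • H (x - y))
    (F' := fun y => η.normed volume y • fderiv ℝ H (x - y))
    (bound := fun y => η.normed volume y * L) (s := univ) Filter.univ_mem
    (.of_forall fun z => (mollify_integrand_integrable η hH.continuous z).aestronglyMeasurable)
    (mollify_integrand_integrable η hH.continuous x) ?_ (.of_forall fun y => ?_)
    (η.integrable_normed.mul_const _) ?_).2
  · refine η.continuous_normed.aestronglyMeasurable.smul ?_
    exact ((measurable_fderiv ℝ H).comp (measurable_const.sub measurable_id)).aestronglyMeasurable
  · rw [lipschitzOnWith_univ]
    refine LipschitzWith.of_dist_le_mul fun z z' => ?_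
    rw [dist_eq_norm, ← smul_sub, norm_smul, Real.coe_nnabs, abs_mul, Real.norm_eq_abs,
      NNReal.abs_eq, mul_assoc]
    refine mul_le_mul_of_nonneg_left ?_ (abs_nonneg _)
    have := hH.dist_le_mul (z - y) (z' - y)
    rwa [dist_sub_right, dist_eq_norm] at this
  · have hae := (quasiMeasurePreserving_sub_left (volume : Measure (EuclideanSpace ℝ (Fin N)))
      x).ae hH.ae_differentiableAt
    filter_upwards [hae] with y hy
    have h1 : HasFDerivAt (fun z => H (z - y)) (fderiv ℝ H (x - y)) x :=
      (hasFDerivAt_comp_sub y).2 hy.hasFDerivAt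
    exact h1.fun_const_smul (η.normed volume y)

lemma norm_gradient_mollify_le (hH : LipschitzWith L H) (x : EuclideanSpace ℝ (Fin N)) :
    ‖gradient (η.normed volume ⋆[lsmul ℝ ℝ, volume] H) x‖ ≤ L := by
  have h1 : ‖gradient (η.normed volume ⋆[lsmul ℝ ℝ, volume] H) x‖ =
      ‖fderiv ℝ (η.normed volume ⋆[lsmul ℝ ℝ, volume] H) x‖ := LinearIsometryEquiv.norm_map _ _
  rw [h1, (hasFDerivAt_mollify η hH x).fderiv]
  exact norm_mollify_le η (fun y => norm_fderiv_le_of_lipschitz ℝ hH) x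

lemma laplacian_mollify_le (b : OrthonormalBasis (Fin N) ℝ (EuclideanSpace ℝ (Fin N)))
    (hH : Continuous H) (hW : Continuous W) {x : EuclideanSpace ℝ (Fin N)} {C s₀ : ℝ}
    (hs₀ : 0 < s₀)
    (h : ∀ z ∈ Metric.ball x η.rOut, ∀ s > 0, s < s₀ →
      ∑ i, (H (z + s • b i) + H (z - s • b i) - 2 * H z) ≤ -(s ^ 2 * W z) + C * s ^ 4) :
    (Δ (η.normed volume ⋆[lsmul ℝ ℝ, volume] H)) x ≤
      -(η.normed volume ⋆[lsmul ℝ ℝ, volume] W) x := by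
  refine laplacian_le_of_second_difference b
    ((mollify_contDiff η hH).of_le (by norm_cast)) (C := C) hs₀ fun s hs hss => ?_
  have hc : ∀ (f : EuclideanSpace ℝ (Fin N) → ℝ) z,
      (η.normed volume ⋆[lsmul ℝ ℝ, volume] f) z = ∫ y, η.normed volume y * f (z - y) :=
    fun f z => rfl
  have i1 : ∀ z, Integrable (fun y => η.normed volume y * H (z - y)) volume :=
    fun z => mollify_integrand_integrable η hH z
  have i2 : Integrable (fun y => η.normed volume y * W (x - y)) volume :=
    mollify_integrand_integrable η hW x
  have i3 : ∀ i, Integrable (fun y => η.normed volume y * H (x + s • b i - y) +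
      η.normed volume y * H (x - s • b i - y)) volume := fun i => (i1 _).add (i1 _)
  have i4 : ∀ i, Integrable (fun y => η.normed volume y * H (x + s • b i - y) +
      η.normed volume y * H (x - s • b i - y) - 2 * (η.normed volume y * H (x - y))) volume :=
    fun i => (i3 i).sub ((i1 _).const_mul 2)
  have i5 : Integrable (fun y => -(s ^ 2 * (η.normed volume y * W (x - y)))) volume :=
    (i2.const_mul (s ^ 2)).neg
  have i6 : Integrable (fun y => C * s ^ 4 * η.normed volume y) volume :=
    η.integrable_normed.const_mul _
  have e1 : ∑ i, ((η.normed volume ⋆[lsmul ℝ ℝ, volume] H) (x + s • b i) +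
      (η.normed volume ⋆[lsmul ℝ ℝ, volume] H) (x - s • b i) -
      2 * (η.normed volume ⋆[lsmul ℝ ℝ, volume] H) x) =
      ∫ y, ∑ i, (η.normed volume y * H (x + s • b i - y) +
        η.normed volume y * H (x - s • b i - y) - 2 * (η.normed volume y * H (x - y))) := by
    rw [integral_finsetSum _ fun i _ => i4 i]
    refine Finset.sum_congr rfl fun i _ => ?_
    rw [integral_sub (i3 i) ((i1 _).const_mul 2), integral_add (i1 _) (i1 _),
      integral_const_mul, hc, hc, hc]
  have e2 : -(s ^ 2 * (η.normed volume ⋆[lsmul ℝ ℝ, volume] W) x) + C * s ^ 4 =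
      ∫ y, (-(s ^ 2 * (η.normed volume y * W (x - y))) + C * s ^ 4 * η.normed volume y) := by
    rw [integral_add i5 i6, integral_neg, integral_const_mul, integral_const_mul,
      η.integral_normed, mul_one, hc]
  rw [e1, e2]
  refine integral_mono (integrable_finsetSum _ fun i _ => i4 i) (i5.add i6) fun y => ?_
  have e3 : ∑ i, (η.normed volume y * H (x + s • b i - y) +
      η.normed volume y * H (x - s • b i - y) - 2 * (η.normed volume y * H (x - y))) =
      η.normed volume y * ∑ i, (H (x - y + s • b i) + H (x - y - s • b i) - 2 * H (x - y)) := by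
    rw [Finset.mul_sum]
    refine Finset.sum_congr rfl fun i _ => ?_
    rw [add_sub_right_comm x (s • b i) y, sub_right_comm x (s • b i) y]
    ring
  have e4 : -(s ^ 2 * (η.normed volume y * W (x - y))) + C * s ^ 4 * η.normed volume y =
      η.normed volume y * (-(s ^ 2 * W (x - y)) + C * s ^ 4) := by
    ring
  simp only [e3, e4]
  by_cases hy : y ∈ Metric.ball (0 : EuclideanSpace ℝ (Fin N)) η.rOut
  · refine mul_le_mul_of_nonneg_left (h (x - y) ?_ s hs hss) (η.nonneg_normed y)
    rw [Metric.mem_ball, dist_eq_norm] at hy ⊢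
    rwa [sub_sub_cancel_left, norm_neg, ← sub_zero y]
  · have : η.normed volume y = 0 := by
      rw [← Function.notMem_support, η.support_normed_eq]
      exact hy
    rw [this, zero_mul, zero_mul]

end Mollification

/-! ### Testing Lipschitz supersolutions against `H¹_c` -/

section WeakTest

open scoped Convolution NNReal Manifold
open ContinuousLinearMap

variable {N : ℕ} {G K U : Set (EuclideanSpace ℝ (Fin N))} {φ : EuclideanSpace ℝ (Fin N) → ℝ}
  {Dφ : EuclideanSpace ℝ (Fin N) → EuclideanSpace ℝ (Fin N)}

lemma HasWeakGradient.ae_eq_zero (hG : IsOpen G) (hφ : HasWeakGradient G φ Dφ) (hK : IsClosed K)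
    (hφK : ∀ᵐ x ∂(volume.restrict G), x ∉ K → φ x = 0) :
    ∀ᵐ x ∂(volume.restrict G), x ∉ K → Dφ x = 0 := by
  have hGK : IsOpen (G \ K) := hG.sdiff hK
  set b := EuclideanSpace.basisFun (Fin N) ℝ
  have hcomp : ∀ i, ∀ᵐ x, x ∈ G \ K → inner ℝ (Dφ x) (b i) = 0 := fun i => by
    refine hGK.ae_eq_zero_of_integral_contDiff_smul_eq_zero
      ((locallyIntegrableOn_inner hφ.locInt_grad (b i)).mono_set sdiff_subset)
      fun ψ hψ hψc hψs => ?_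
    have h1 := hφ.integral_eq ψ hψ hψc (hψs.trans sdiff_subset) (b i)
    have h2 : ∫ x in G, φ x * fderiv ℝ ψ x (b i) = 0 := by
      refine integral_eq_zero_of_ae ?_
      filter_upwards [hφK] with x hx
      by_cases hxK : x ∈ K
      · have : fderiv ℝ ψ x = 0 := image_eq_zero_of_notMem_tsupport fun h' =>
          (hψs (tsupport_fderiv_subset ℝ h')).2 hxK
        simp [this]
      · simp [hx hxK]
    have h3 : ∫ x in G, inner ℝ (Dφ x) (b i) * ψ x = ∫ x, ψ x • inner ℝ (Dφ x) (b i) := by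
      simp_rw [smul_eq_mul, mul_comm (ψ _)]
      refine setIntegral_eq_integral_of_forall_compl_eq_zero fun x hx => ?_
      rw [image_eq_zero_of_notMem_tsupport fun h' => hx (hψs h').1, mul_zero]
    rw [← h3]
    linarith
  rw [ae_restrict_iff' hG.measurableSet]
  filter_upwards [ae_all_iff.2 hcomp] with x hx hxG hxK
  rw [← b.sum_repr' (Dφ x)]
  refine Finset.sum_eq_zero fun i _ => ?_
  rw [real_inner_comm, hx i ⟨hxG, hxK⟩, zero_smul]

lemma exists_smooth_cutoff (hK : IsCompact K) (hG : IsOpen G) (hKG : K ⊆ G) :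
    ∃ χ : EuclideanSpace ℝ (Fin N) → ℝ, ContDiff ℝ ∞ χ ∧ HasCompactSupport χ ∧ tsupport χ ⊆ G ∧
      ∀ x ∈ K, ∀ᶠ y in nhds x, χ y = 1 := by
  obtain ⟨L₁, hL₁, hKL₁, hL₁G⟩ := exists_compact_between hK hG hKG
  obtain ⟨L₂, hL₂, hL₁₂, hL₂G⟩ := exists_compact_between hL₁ hG hL₁G
  obtain ⟨χ, h0, h1, -⟩ := exists_contMDiffMap_zero_one_of_isClosed
    𝓘(ℝ, EuclideanSpace ℝ (Fin N)) (n := ⊤) (isOpen_interior (s := L₂)).isClosed_compl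
    hL₁.isClosed (disjoint_compl_left_iff_subset.2 hL₁₂)
  have hsub : Function.support χ ⊆ L₂ := fun x hx => by
    by_contra h'
    exact hx (h0 fun h'' => h' (interior_subset h''))
  refine ⟨χ, χ.contMDiff.contDiff, HasCompactSupport.of_support_subset_isCompact hL₂ hsub,
    (closure_minimal hsub hL₂.isClosed).trans hL₂G, fun x hx => ?_⟩
  filter_upwards [isOpen_interior.mem_nhds (hKL₁ hx)] with y hy
  exact h1 (interior_subset hy)

/-- Integration by parts of a function in `H¹_c` against an arbitrary smooth function. -/
lemma integral_inner_gradient_of_smooth (hG : IsOpen G) (hφ : HasWeakGradient G φ Dφ)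
    (hK : IsCompact K) (hKG : K ⊆ G) (hφK : ∀ᵐ x ∂(volume.restrict G), x ∉ K → φ x = 0)
    {f : EuclideanSpace ℝ (Fin N) → ℝ} (hf : ContDiff ℝ ∞ f) :
    ∫ x in G, inner ℝ (gradient f x) (Dφ x) = ∫ x in G, -(Δ f) x * φ x := by
  obtain ⟨χ, hχ, hχc, hχG, hχK⟩ := exists_smooth_cutoff hK hG hKG
  have h1 := hφ.integral_inner_gradient hG (φ := fun x => χ x * f x) (hχ.mul hf) hχc.mul_right
    ((tsupport_mul_subset_left).trans hχG)
  have hloc : ∀ x ∈ K, (fun x => χ x * f x) =ᶠ[nhds x] f := fun x hx => by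
    filter_upwards [hχK x hx] with y hy
    rw [hy, one_mul]
  have h2 : ∫ x in G, inner ℝ (Dφ x) (gradient (fun x => χ x * f x) x) =
      ∫ x in G, inner ℝ (gradient f x) (Dφ x) := by
    refine integral_congr_ae ?_
    filter_upwards [hφ.ae_eq_zero hG hK.isClosed hφK] with x hx
    by_cases hxK : x ∈ K
    · rw [real_inner_comm, gradient, gradient, (hloc x hxK).fderiv_eq]
    · rw [hx hxK, inner_zero_left, inner_zero_right]
  have h3 : ∫ x in G, φ x * (Δ (fun x => χ x * f x)) x = ∫ x in G, (Δ f) x * φ x := by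
    refine integral_congr_ae ?_
    filter_upwards [hφK] with x hx
    by_cases hxK : x ∈ K
    · rw [(InnerProductSpace.laplacian_congr_nhds (hloc x hxK)).self_of_nhds, mul_comm]
    · rw [hx hxK, mul_zero, zero_mul]
  rw [h2, h3] at h1
  simp_rw [neg_mul]
  rw [h1, integral_neg]

lemma integrable_of_memLp_of_ae_eq_zero {F : Type*} [NormedAddCommGroup F]
    {g : EuclideanSpace ℝ (Fin N) → F} (hG : IsOpen G) (hg : MemLp g 2 (volume.restrict G))
    (hK : IsCompact K) (hKG : K ⊆ G) (h0 : ∀ᵐ x ∂(volume.restrict G), x ∉ K → g x = 0) :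
    Integrable g (volume.restrict G) := by
  have : IsFiniteMeasure (volume.restrict K) := ⟨by simpa using hK.measure_lt_top⟩
  have h1 : IntegrableOn g K volume :=
    (hg.mono_measure (Measure.restrict_mono hKG le_rfl)).integrable one_le_two
  refine IntegrableOn.of_ae_sdiff_eq_zero h1 hG.measurableSet.nullMeasurableSet ?_
  filter_upwards [(ae_restrict_iff' hG.measurableSet).1 h0] with x hx hxGK
  exact hx hxGK.1 hxGK.2

/-- A family of mollifiers concentrating at the origin. -/
noncomputable def mollifier (N n : ℕ) : ContDiffBump (0 : EuclideanSpace ℝ (Fin N)) where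
  rIn := 1 / (2 * (n + 1))
  rOut := 1 / (n + 1)
  rIn_pos := by positivity
  rIn_lt_rOut := by
    have : (0 : ℝ) < n + 1 := by positivity
    exact one_div_lt_one_div_of_lt this (by linarith)

lemma mollifier_rOut_tendsto : Filter.Tendsto (fun n => (mollifier N n).rOut) Filter.atTop
    (nhds 0) := tendsto_one_div_add_atTop_nhds_zero_nat

/-- A Lipschitz function `H` whose second differences are bounded by `-W` near the support of a
nonnegative `φ ∈ H¹_c` satisfies `-ΔH ≥ W` when tested against `φ`. The mollifications of `H`
satisfy the inequality pointwise; their gradients converge boundedly almost everywhere. -/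
lemma integral_inner_gradient_ge {H W : EuclideanSpace ℝ (Fin N) → ℝ} {L : ℝ≥0} {B : ℝ}
    (hG : IsOpen G) (hφ : IsH1Compact G φ Dφ) (hφ0 : ∀ᵐ x ∂(volume.restrict G), 0 ≤ φ x)
    (hK : IsCompact K) (hKG : K ⊆ G) (hφK : ∀ᵐ x ∂(volume.restrict G), x ∉ K → φ x = 0)
    (hH : LipschitzWith L H) (hW : Continuous W) (hWB : ∀ x, ‖W x‖ ≤ B)
    (hU : IsOpen U) (hKU : K ⊆ U) (b : OrthonormalBasis (Fin N) ℝ (EuclideanSpace ℝ (Fin N)))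
    {C s₀ : ℝ} (hs₀ : 0 < s₀)
    (hsd : ∀ z ∈ U, ∀ s > 0, s < s₀ →
      ∑ i, (H (z + s • b i) + H (z - s • b i) - 2 * H z) ≤ -(s ^ 2 * W z) + C * s ^ 4) :
    ∫ x in G, W x * φ x ≤ ∫ x in G, inner ℝ (gradient H x) (Dφ x) := by
  have hφi := integrable_of_memLp_of_ae_eq_zero hG hφ.memLp hK hKG hφK
  have hDφ0 := hφ.weakGrad.ae_eq_zero hG hK.isClosed hφK
  have hDφi := integrable_of_memLp_of_ae_eq_zero hG hφ.memLp_grad hK hKG hDφ0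
  set Hn : ℕ → EuclideanSpace ℝ (Fin N) → ℝ := fun n =>
    (mollifier N n).normed volume ⋆[lsmul ℝ ℝ, volume] H with hHn
  set Wn : ℕ → EuclideanSpace ℝ (Fin N) → ℝ := fun n =>
    (mollifier N n).normed volume ⋆[lsmul ℝ ℝ, volume] W with hWn
  have hHs : ∀ n, ContDiff ℝ ∞ (Hn n) := fun n => mollify_contDiff _ hH.continuous
  have hWc : ∀ n, Continuous (Wn n) := fun n => (mollify_contDiff _ hW).continuous
  have hgc : ∀ n, Continuous (gradient (Hn n)) := fun n =>
    (LinearIsometryEquiv.continuous _).comp ((hHs n).continuous_fderiv (by simp))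
  have limW : Filter.Tendsto (fun n => ∫ x in G, Wn n x * φ x) Filter.atTop
      (nhds (∫ x in G, W x * φ x)) := by
    refine tendsto_integral_of_dominated_convergence (fun x => B * ‖φ x‖)
      (fun n => (hWc n).aestronglyMeasurable.mul hφi.aestronglyMeasurable)
      (hφi.norm.const_mul B) (fun n => .of_forall fun x => ?_) (.of_forall fun x => ?_)
    · rw [norm_mul]
      gcongr
      exact norm_mollify_le _ hWB x
    · exact (ContDiffBump.convolution_tendsto_right_of_continuous mollifier_rOut_tendsto hW
        x).mul_const _
  have limH : Filter.Tendsto (fun n => ∫ x in G, inner ℝ (gradient (Hn n) x) (Dφ x)) Filter.atTop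
      (nhds (∫ x in G, inner ℝ (gradient H x) (Dφ x))) := by
    refine tendsto_integral_of_dominated_convergence (fun x => L * ‖Dφ x‖)
      (fun n => (hgc n).aestronglyMeasurable.inner hDφi.aestronglyMeasurable)
      (hDφi.norm.const_mul L) (fun n => .of_forall fun x => ?_) ?_
    · refine (norm_inner_le_norm _ _).trans ?_
      gcongr
      exact norm_gradient_mollify_le _ hH x
    · have hli : LocallyIntegrable (fderiv ℝ H) (volume : Measure (EuclideanSpace ℝ (Fin N))) := by
        have : MemLp (fderiv ℝ H) ⊤ (volume : Measure (EuclideanSpace ℝ (Fin N))) :=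
          memLp_top_of_bound (measurable_fderiv ℝ H).aestronglyMeasurable L
            (.of_forall fun x => norm_fderiv_le_of_lipschitz ℝ hH)
        exact this.locallyIntegrable le_top
      have hae := ContDiffBump.ae_convolution_tendsto_right_of_locallyIntegrable (K := 2)
        (φ := mollifier N) (l := Filter.atTop) mollifier_rOut_tendsto (.of_forall fun n => by
          have : (mollifier N n).rOut = 2 * (mollifier N n).rIn := by
            simp only [mollifier]; field_simp
          exact this.le) hli
      filter_upwards [ae_restrict_of_ae hae] with x hx
      have hg : Filter.Tendsto (fun n => gradient (Hn n) x) Filter.atTop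
          (nhds (gradient H x)) := by
        have e : ∀ n, gradient (Hn n) x = (InnerProductSpace.toDual ℝ _).symm
            (((mollifier N n).normed volume ⋆[lsmul ℝ ℝ, volume] (fderiv ℝ H)) x) := fun n => by
          rw [gradient, (hasFDerivAt_mollify (mollifier N n) hH x).fderiv]
        simp_rw [e]
        exact ((LinearIsometryEquiv.continuous _).tendsto _).comp hx
      exact hg.inner tendsto_const_nhds
  obtain ⟨δ, hδ, hδU⟩ := hK.exists_thickening_subset_open hU hKU
  refine le_of_tendsto_of_tendsto limW limH ?_
  filter_upwards [mollifier_rOut_tendsto.eventually (gt_mem_nhds hδ)] with n hn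
  rw [integral_inner_gradient_of_smooth hG hφ.weakGrad hK hKG hφK (hHs n)]
  have hcK : ∀ f : EuclideanSpace ℝ (Fin N) → ℝ, Continuous f →
      Integrable (fun x => f x * φ x) (volume.restrict G) := fun f hf => by
    have h0 : IntegrableOn φ K volume := hφi.mono_measure (Measure.restrict_mono hKG le_rfl)
    have h1 : IntegrableOn (fun x => f x * φ x) K volume := h0.continuousOn_mul hf.continuousOn hK
    refine IntegrableOn.of_ae_sdiff_eq_zero h1 hG.measurableSet.nullMeasurableSet ?_
    filter_upwards [(ae_restrict_iff' hG.measurableSet).1 hφK] with x hx hxGK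
    rw [hx hxGK.1 hxGK.2, mul_zero]
  refine integral_mono_ae (hcK _ (hWc n))
    (hcK _ (laplacian_continuous ((hHs n).of_le (by norm_cast))).neg) ?_
  filter_upwards [hφ0, hφK] with x hx0 hxK
  by_cases hx : x ∈ K
  · refine mul_le_mul_of_nonneg_right ?_ hx0
    have := laplacian_mollify_le (mollifier N n) b hH.continuous hW (x := x) (C := C) hs₀
      fun z hz => hsd z (hδU (Metric.mem_thickening_iff.2 ⟨x, hx, lt_trans hz hn⟩))
    simp only [hHn, hWn]
    linarith
  · rw [hxK hx, mul_zero, mul_zero]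

end WeakTest

/-! ### The barrier is a positive local super-harmonic -/

section BarrierSuperharmonic

variable {N : ℕ} {Ω : Set (EuclideanSpace ℝ (Fin N))} {μ ρ a : ℝ}

/-- The barrier `√δ - δ`. -/
noncomputable def barrier (Ω : Set (EuclideanSpace ℝ (Fin N))) (x : EuclideanSpace ℝ (Fin N)) :
    ℝ := barrierProfile (bdist Ω x)

/-- A globally Lipschitz function that agrees with the barrier where `δ ≥ a`. -/
noncomputable def truncBarrier (Ω : Set (EuclideanSpace ℝ (Fin N))) (a : ℝ)
    (x : EuclideanSpace ℝ (Fin N)) : ℝ := barrierProfile (max (bdist Ω x) a)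

/-- A bounded continuous function that agrees with `(√δ - δ) / (4δ²)` where `δ ≥ a`. -/
noncomputable def truncWeight (Ω : Set (EuclideanSpace ℝ (Fin N))) (a : ℝ)
    (x : EuclideanSpace ℝ (Fin N)) : ℝ :=
  barrierProfile (max (bdist Ω x) a) / (4 * max (bdist Ω x) a ^ 2)

lemma barrierProfile_continuous : Continuous barrierProfile :=
  Real.continuous_sqrt.sub continuous_id

lemma barrier_continuous : Continuous (barrier Ω) :=
  barrierProfile_continuous.comp bdist_continuous

lemma truncBarrier_eq {x : EuclideanSpace ℝ (Fin N)} (hx : a ≤ bdist Ω x) :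
    truncBarrier Ω a x = barrier Ω x := by
  rw [truncBarrier, barrier, max_eq_left hx]

lemma truncWeight_eq {x : EuclideanSpace ℝ (Fin N)} (hx : a ≤ bdist Ω x) :
    truncWeight Ω a x = barrier Ω x / (4 * bdist Ω x ^ 2) := by
  rw [truncWeight, barrier, max_eq_left hx]

lemma truncBarrier_lipschitz (ha : 0 < a) :
    LipschitzWith (Real.toNNReal (1 / √a + 1)) (truncBarrier Ω a) := by
  have hσ : 0 < √a := Real.sqrt_pos.2 ha
  refine LipschitzWith.of_dist_le_mul fun x y => ?_
  rw [Real.coe_toNNReal _ (by positivity)]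
  have h1 : |max (bdist Ω x) a - max (bdist Ω y) a| ≤ dist x y := by
    refine (abs_max_sub_max_le_abs _ _ _).trans ?_
    have := (Metric.lipschitz_infDist_pt (frontier Ω)).dist_le_mul x y
    rwa [NNReal.coe_one, one_mul] at this
  rw [Real.dist_eq, truncBarrier, truncBarrier]
  have hs : a ≤ max (bdist Ω x) a := le_max_right _ _
  have ht : a ≤ max (bdist Ω y) a := le_max_right _ _
  set s := max (bdist Ω x) a
  set t := max (bdist Ω y) a
  have h2 : |√s - √t| ≤ 1 / √a * |s - t| := by
    have e : s - t = (√s - √t) * (√s + √t) := by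
      have e' : (√s - √t) * (√s + √t) = √s ^ 2 - √t ^ 2 := by ring
      rw [e', Real.sq_sqrt (ha.le.trans hs), Real.sq_sqrt (ha.le.trans ht)]
    rw [div_mul_eq_mul_div, one_mul, le_div_iff₀ hσ, e, abs_mul]
    refine mul_le_mul_of_nonneg_left ?_ (abs_nonneg _)
    refine le_trans ?_ (le_abs_self _)
    linarith [Real.sqrt_le_sqrt hs, Real.sqrt_nonneg t]
  have h3 : |barrierProfile s - barrierProfile t| ≤ |√s - √t| + |s - t| := by
    have e : barrierProfile s - barrierProfile t = (√s - √t) - (s - t) := by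
      simp only [barrierProfile]; ring
    rw [e]
    exact abs_sub _ _
  calc |barrierProfile s - barrierProfile t| ≤ (1 / √a + 1) * |s - t| := by linarith
    _ ≤ (1 / √a + 1) * dist x y := by gcongr

lemma truncWeight_continuous (ha : 0 < a) : Continuous (truncWeight Ω a) := by
  have hm : Continuous fun x => max (bdist Ω x) a := bdist_continuous.max continuous_const
  refine (barrierProfile_continuous.comp hm).div (continuous_const.mul (hm.pow 2)) fun x => ?_
  have : 0 < max (bdist Ω x) a := lt_max_of_lt_right ha
  positivity

lemma norm_truncWeight_le (ha : 0 < a) (x : EuclideanSpace ℝ (Fin N)) :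
    ‖truncWeight Ω a x‖ ≤ 1 / (2 * a) + 1 / (4 * a ^ 2) := by
  have hs : a ≤ max (bdist Ω x) a := le_max_right _ _
  rw [truncWeight]
  set s := max (bdist Ω x) a
  have hs0 : 0 < s := ha.trans_le hs
  have h1 : |barrierProfile s| ≤ 2 * s + 1 := by
    have h2 : √s ≤ s + 1 := Real.sqrt_le_iff.2 ⟨by positivity, by nlinarith⟩
    rw [abs_le, barrierProfile]
    constructor <;> linarith [Real.sqrt_nonneg s]
  rw [Real.norm_eq_abs, abs_div, abs_of_pos (by positivity : 0 < 4 * s ^ 2)]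
  calc |barrierProfile s| / (4 * s ^ 2) ≤ (2 * s + 1) / (4 * s ^ 2) := by gcongr
    _ = 1 / (2 * s) + 1 / (4 * s ^ 2) := by field_simp; ring
    _ ≤ 1 / (2 * a) + 1 / (4 * a ^ 2) := by gcongr

lemma gradient_truncBarrier_eq {x : EuclideanSpace ℝ (Fin N)} (hx : a < bdist Ω x) :
    gradient (truncBarrier Ω a) x = gradient (barrier Ω) x := by
  have : truncBarrier Ω a =ᶠ[nhds x] barrier Ω := by
    filter_upwards [bdist_continuous.continuousAt.eventually (lt_mem_nhds hx)] with y hy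
    exact truncBarrier_eq hy.le
  rw [gradient, gradient, this.fderiv_eq]

lemma exists_lt_bdist_of_isCompact {K : Set (EuclideanSpace ℝ (Fin N))} (hK : IsCompact K)
    (hpos : ∀ x ∈ K, 0 < bdist Ω x) : ∃ a > 0, ∀ x ∈ K, a < bdist Ω x := by
  rcases K.eq_empty_or_nonempty with rfl | hne
  · exact ⟨1, one_pos, fun x hx => absurd hx (notMem_empty x)⟩
  · obtain ⟨x₀, hx₀, hmin⟩ := hK.exists_isMinOn hne (bdist_continuous (Ω := Ω)).continuousOn
    refine ⟨bdist Ω x₀ / 2, half_pos (hpos x₀ hx₀), fun x hx => ?_⟩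
    have : bdist Ω x₀ ≤ bdist Ω x := hmin hx
    linarith [hpos x₀ hx₀]

lemma barrier_isH1Loc {G : Set (EuclideanSpace ℝ (Fin N))} (hG : IsOpen G)
    (hpos : ∀ x ∈ G, 0 < bdist Ω x) : IsH1Loc G (barrier Ω) (gradient (barrier Ω)) := by
  have hmeas : AEStronglyMeasurable (gradient (barrier Ω))
      (volume : Measure (EuclideanSpace ℝ (Fin N))) :=
    (LinearIsometryEquiv.continuous _).comp_aestronglyMeasurable
      (measurable_fderiv ℝ (barrier Ω)).aestronglyMeasurable
  have hmem : ∀ (p : ENNReal), ∀ K ⊆ G, IsCompact K →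
      MemLp (gradient (barrier Ω)) p (volume.restrict K) := fun p K hKG hK => by
    have : IsFiniteMeasure (volume.restrict K) := ⟨by simpa using hK.measure_lt_top⟩
    obtain ⟨a, ha, hKa⟩ := exists_lt_bdist_of_isCompact hK fun x hx => hpos x (hKG hx)
    refine MemLp.of_bound hmeas.restrict (Real.toNNReal (1 / √a + 1)) ?_
    rw [ae_restrict_iff' hK.measurableSet]
    refine .of_forall fun x hx => ?_
    rw [← gradient_truncBarrier_eq (hKa x hx)]
    have : ‖gradient (truncBarrier Ω a) x‖ = ‖fderiv ℝ (truncBarrier Ω a) x‖ :=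
      LinearIsometryEquiv.norm_map _ _
    rw [this]
    exact norm_fderiv_le_of_lipschitz ℝ (truncBarrier_lipschitz ha)
  refine ⟨⟨barrier_continuous.locallyIntegrable.locallyIntegrableOn _, ?_, ?_⟩, ?_, hmem 2⟩
  · rw [locallyIntegrableOn_iff hG.isLocallyClosed]
    exact fun K hKG hK => memLp_one_iff_integrable.1 (hmem 1 K hKG hK)
  · intro ψ hψ hψc hψG v
    obtain ⟨a, ha, hKa⟩ := exists_lt_bdist_of_isCompact hψc fun x hx => hpos x (hψG hx)
    have hH := truncBarrier_lipschitz (Ω := Ω) ha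
    obtain ⟨D, hD⟩ := ContDiff.lipschitzWith_of_hasCompactSupport hψc hψ (by simp)
    have hibp := hH.integral_lineDeriv_mul_eq (μ := volume) hD hψc v
    have e0 : ∀ x, x ∉ tsupport ψ → fderiv ℝ ψ x = 0 := fun x hx =>
      image_eq_zero_of_notMem_tsupport fun h' => hx (tsupport_fderiv_subset ℝ h')
    have e1 : ∫ x in G, barrier Ω x * fderiv ℝ ψ x v =
        -∫ x, lineDeriv ℝ ψ x (-v) * truncBarrier Ω a x := by
      rw [setIntegral_eq_integral_of_forall_compl_eq_zero (fun x hx => by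
        rw [e0 x fun h' => hx (hψG h')]; simp), ← integral_neg]
      refine integral_congr_ae (.of_forall fun x => ?_)
      have hd : DifferentiableAt ℝ ψ x := (hψ.differentiable (by simp)).differentiableAt
      simp only [hd.lineDeriv_eq_fderiv, map_neg]
      by_cases hx : x ∈ tsupport ψ
      · rw [truncBarrier_eq (hKa x hx).le]; ring
      · simp [e0 x hx]
    have e2 : ∫ x in G, inner ℝ (gradient (barrier Ω) x) v * ψ x =
        ∫ x, lineDeriv ℝ (truncBarrier Ω a) x v * ψ x := by
      rw [setIntegral_eq_integral_of_forall_compl_eq_zero (fun x hx => by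
        rw [image_eq_zero_of_notMem_tsupport fun h' => hx (hψG h'), mul_zero])]
      refine integral_congr_ae ?_
      filter_upwards [hH.ae_differentiableAt] with x hd
      by_cases hx : x ∈ tsupport ψ
      · rw [hd.lineDeriv_eq_fderiv, ← gradient_truncBarrier_eq (hKa x hx), inner_gradient_left]
      · rw [image_eq_zero_of_notMem_tsupport hx, mul_zero, mul_zero]
    rw [e1, e2, hibp]
  · intro K _ hK
    have : IsFiniteMeasure (volume.restrict K) := ⟨by simpa using hK.measure_lt_top⟩
    obtain ⟨B, hB⟩ := hK.exists_bound_of_continuousOn (barrier_continuous (Ω := Ω)).continuousOn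
    refine MemLp.of_bound barrier_continuous.aestronglyMeasurable B ?_
    rw [ae_restrict_iff' hK.measurableSet]
    exact .of_forall hB

/-- For `μ ≤ 1/4` the barrier is a positive super-harmonic in a thin strip. -/
lemma exists_isPositiveLocalSuperharmonic (hN : 0 < N) (hΩ : IsBoundedC2Domain Ω)
    (hμ : μ ≤ 1 / 4) : ∃ h, IsPositiveLocalSuperharmonic Ω μ h := by
  set b := EuclideanSpace.basisFun (Fin N) ℝ
  obtain ⟨ρ, hρ, hρ8, hsd⟩ := exists_barrier_second_difference hN hΩ b
  have hG := strip_isOpen hΩ.isOpen ρ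
  have hδ : ∀ x ∈ strip Ω ρ, 0 < bdist Ω x := fun x hx =>
    bdist_pos hΩ.isOpen (hΩ.frontier_nonempty hN) hx.1
  have hpos : ∀ x ∈ strip Ω ρ, 0 < barrier Ω x := fun x hx =>
    barrierProfile_pos (hδ x hx) (by linarith [hx.2])
  refine ⟨barrier Ω, ρ, hρ, ⟨barrier_continuous.continuousOn, gradient (barrier Ω),
    barrier_isH1Loc hG hδ, fun φ Dφ hφ hφ0 => ?_⟩, hpos⟩
  obtain ⟨K, hKG, hK, hφK⟩ := hφ.compactSupport
  obtain ⟨a, ha, hKa⟩ := exists_lt_bdist_of_isCompact hK fun x hx => hδ x (hKG hx)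
  obtain ⟨C, s₀, hs₀, hsd⟩ := hsd a ha
  have ha2 : 0 < a / 2 := half_pos ha
  have hmain := integral_inner_gradient_ge (U := strip Ω ρ ∩ {x | a < bdist Ω x}) (C := C)
    (s₀ := min s₀ (a / 2)) hG hφ hφ0 hK hKG hφK (truncBarrier_lipschitz ha2)
    (truncWeight_continuous ha2) (norm_truncWeight_le ha2)
    (hG.inter (isOpen_lt continuous_const bdist_continuous)) (fun x hx => ⟨hKG hx, hKa x hx⟩) b
    (lt_min hs₀ ha2) fun z hz s hs hss => by
      have hz2 : a < bdist Ω z := hz.2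
      have hnear : ∀ v : EuclideanSpace ℝ (Fin N), ‖v‖ = s → a / 2 ≤ bdist Ω (z + v) :=
        fun v hv => by
          have h1 : bdist Ω z ≤ bdist Ω (z + v) + dist z (z + v) :=
            Metric.infDist_le_infDist_add_dist
          rw [dist_self_add_right, hv] at h1
          linarith [hss.trans_le (min_le_right s₀ (a / 2))]
      have hn : ∀ i, ‖s • b i‖ = s := fun i => by
        rw [norm_smul, b.norm_eq_one, mul_one, Real.norm_eq_abs, abs_of_pos hs]
      have h1 := hsd z hz.1 hz2.le s hs (hss.trans_le (min_le_left _ _))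
      have hz3 : a / 2 ≤ bdist Ω z := by linarith
      rw [truncWeight_eq hz3, barrier]
      refine le_trans (le_of_eq (Finset.sum_congr rfl fun i _ => ?_)) h1
      rw [truncBarrier_eq (hnear _ (hn i)), sub_eq_add_neg z,
        truncBarrier_eq (hnear _ (by rw [norm_neg, hn i])), truncBarrier_eq hz3]
      simp only [barrier]
  have e1 : ∫ x in strip Ω ρ, inner ℝ (gradient (truncBarrier Ω (a / 2)) x) (Dφ x) =
      ∫ x in strip Ω ρ, inner ℝ (gradient (barrier Ω) x) (Dφ x) := by
    refine integral_congr_ae ?_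
    filter_upwards [hφ.weakGrad.ae_eq_zero hG hK.isClosed hφK] with x hx
    by_cases hxK : x ∈ K
    · rw [gradient_truncBarrier_eq (by linarith [hKa x hxK])]
    · rw [hx hxK, inner_zero_right, inner_zero_right]
  have e2 : ∫ x in strip Ω ρ, μ / bdist Ω x ^ 2 * barrier Ω x * φ x =
      4 * μ * ∫ x in strip Ω ρ, truncWeight Ω (a / 2) x * φ x := by
    rw [← integral_const_mul]
    refine integral_congr_ae ?_
    filter_upwards [hφK] with x hx
    by_cases hxK : x ∈ K
    · rw [truncWeight_eq (by linarith [hKa x hxK])]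
      have := hδ x (hKG hxK)
      field_simp
    · rw [hx hxK, mul_zero, mul_zero, mul_zero]
  have e3 : 0 ≤ ∫ x in strip Ω ρ, truncWeight Ω (a / 2) x * φ x := by
    refine integral_nonneg_of_ae ?_
    filter_upwards [hφ0, hφK] with x hx0 hx
    by_cases hxK : x ∈ K
    · rw [truncWeight_eq (by linarith [hKa x hxK])]
      exact mul_nonneg (div_nonneg (hpos x (hKG hxK)).le (by positivity)) hx0
    · simp [hx hxK]
  rw [weakForm, ← e1, e2]
  nlinarith

end BarrierSuperharmonic

end HardyPotential


theorem theorem2p1 (N : ℕ) (hN : 2 ≤ N) (Ω : Set (EuclideanSpace ℝ (Fin N)))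
    (hΩ : HardyPotential.IsBoundedC2Domain Ω) (μ : ℝ) :
    ((∃ h : EuclideanSpace ℝ (Fin N) → ℝ, HardyPotential.IsPositiveLocalSuperharmonic Ω μ h) ↔
        μ ≤ 1 / 4) ∧
      (1 / 4 < μ → ¬ ∃ h : EuclideanSpace ℝ (Fin N) → ℝ,
        HardyPotential.IsSolution Ω μ Ω h ∧ (∀ x ∈ Ω, 0 ≤ h x) ∧ ∃ x ∈ Ω, h x ≠ 0) := by
  have hN0 : 0 < N := by omega
  refine ⟨⟨fun ⟨h, hh⟩ => hh.le_quarter hN0 hΩ,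
    fun hμ => HardyPotential.exists_isPositiveLocalSuperharmonic hN0 hΩ hμ⟩, ?_⟩
  rintro hμ ⟨h, hsol, h0, x, hx, hne⟩
  exact hne (hsol.eq_zero hN0 hΩ hμ h0 x hx)
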